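/- Fix an integer $n \ge 2$. A problem is a set $P$ of pairs (instance, solution), where instances and solutions are elements of $\mathbb{N}^{\mathbb{N}}$ or of $\mathbb{N}$, and $\operatorname{dom}(P)$ is its set of instances. $P$ is strongly Weihrauch reducible to $Q$, $P \leq_{\mathrm{sW}} Q$, if there are partial computable functionals $\Phi, \Psi$ such that for every $I \in \operatorname{dom}(P)$, $\Phi(I)$ is defined and lies in $\operatorname{dom}(Q)$, and for every $R$ with $(\Phi(I), R) \in Q$, $\Psi(R)$ is defined and $(I, \Psi(R)) \in P$; $P \equiv_{\mathrm{sW}} Q$ means $P \leq_{\mathrm{sW}} Q$ and $Q \leq_{\mathrm{sW}} P$. Let $$\mathsf{C}_{\mathbb{N}} = \{(f, m) : f \in \mathbb{N}^{\mathbb{N}},\ m \in \mathbb{N},\ m \notin \operatorname{range}(f)\}.$$ Let $\mathsf{VSB}_n$ be the problem whose instances are (codes in $\mathbb{N}^{\mathbb{N}}$ of) countable vector spaces of dimension exactly $n$, given by a countable field with underlying set $K \subseteq \mathbb{N}$ and a vector space over it with underlying set $V \subseteq \mathbb{N}$, through the characteristic functions of $K$ and $V$, the operations and the distinguished elements, and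 whose solutions are the (characteristic functions of) bases of the given space. Let $\mathsf{VSB}_n^{\mathbb{Q}}$ be its restriction to instances whose field is isomorphic to $\mathbb{Q}$. Then $$\mathsf{VSB}_n \equiv_{\mathrm{sW}} \mathsf{C}_{\mathbb{N}} \quad\text{and}\quad \mathsf{VSB}_n^{\mathbb{Q}} \equiv_{\mathrm{sW}} \mathsf{C}_{\mathbb{N}}.$$ -/

import Mathlib

namespace WR

/-- Partial recursive functionals `F : ℕ^ℕ × ℕ ⇀ ℕ`: the functions of a number `n` that are partial
recursive in an oracle `g : ℕ → ℕ`, uniformly in `g` (one and the same program for all oracles).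
This is the uniform version of Mathlib's `Nat.RecursiveIn`, with the same closure conditions. -/
inductive RecursiveFunctional : ((ℕ → ℕ) → ℕ →. ℕ) → Prop
  | zero : RecursiveFunctional fun _ _ => Part.some 0
  | succ : RecursiveFunctional fun _ n => Part.some (n + 1)
  | left : RecursiveFunctional fun _ n => Part.some (Nat.unpair n).1
  | right : RecursiveFunctional fun _ n => Part.some (Nat.unpair n).2
  | oracle : RecursiveFunctional fun g n => Part.some (g n)
  | pair {F H : (ℕ → ℕ) → ℕ →. ℕ} (hF : RecursiveFunctional F) (hH : RecursiveFunctional H) :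
      RecursiveFunctional fun g n => (Nat.pair <$> F g n <*> H g n)
  | comp {F H : (ℕ → ℕ) → ℕ →. ℕ} (hF : RecursiveFunctional F) (hH : RecursiveFunctional H) :
      RecursiveFunctional fun g n => (H g n >>= F g)
  | prec {F H : (ℕ → ℕ) → ℕ →. ℕ} (hF : RecursiveFunctional F) (hH : RecursiveFunctional H) :
      RecursiveFunctional fun g p =>
        let (a, n) := Nat.unpair p
        n.rec (F g a) fun y IH => do
          let i ← IH
          H g (Nat.pair a (Nat.pair y i))
  | rfind {F : (ℕ → ℕ) → ℕ →. ℕ} (hF : RecursiveFunctional F) :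
      RecursiveFunctional fun g a =>
        Nat.rfind fun n => (fun m => m = 0) <$> F g (Nat.pair a n)

/-- The two kinds of instances and solutions of Weihrauch problems are numbers and functions
`ℕ → ℕ`. `name x` is the oracle through which a functional reads or writes `x`. -/
class Named (X : Type) where
  name : X → ℕ → ℕ

/-- A function is its own name. -/
instance : Named (ℕ → ℕ) := ⟨fun f => f⟩

/-- A number is named by the constant function with that value. -/
instance : Named ℕ := ⟨fun n _ => n⟩

/-- `Φ` is computable: a partial recursive functional computes (the name of) `Φ x` from
(the name of) `x`, whenever `Φ x` is defined. -/
def ComputableMap {X Y : Type} [Named X] [Named Y] (Φ : X →. Y) : Prop :=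
  ∃ F : (ℕ → ℕ) → ℕ →. ℕ, RecursiveFunctional F ∧
    ∀ x, ∀ y ∈ Φ x, ∀ k, Named.name y k ∈ F (Named.name x) k

/-- The domain of a problem: its instances. -/
def dom {X Y : Type} (P : Set (X × Y)) : Set X := {x | ∃ y, (x, y) ∈ P}

/-- Strong Weihrauch reducibility: `Φ` turns instances of `P` into instances of `Q`, and `Ψ` turns
solutions of the latter into solutions of the former, without access to the instance of `P`. -/
def StrongReducible {X Y X' Y' : Type} [Named X] [Named Y] [Named X'] [Named Y']
    (P : Set (X × Y)) (Q : Set (X' × Y')) : Prop :=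
  ∃ (Φ : X →. X') (Ψ : Y' →. Y), ComputableMap Φ ∧ ComputableMap Ψ ∧
    ∀ x ∈ dom P, ∃ x' ∈ Φ x, x' ∈ dom Q ∧
      ∀ r, (x', r) ∈ Q → ∃ s ∈ Ψ r, (x, s) ∈ P

/-- Strong Weihrauch equivalence. -/
def StrongEquiv {X Y X' Y' : Type} [Named X] [Named Y] [Named X'] [Named Y']
    (P : Set (X × Y)) (Q : Set (X' × Y')) : Prop :=
  StrongReducible P Q ∧ StrongReducible Q P

/-- Closed choice on the natural numbers. -/
def CN : Set ((ℕ → ℕ) × ℕ) := {x | x.2 ∉ Set.range x.1}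

/-- The characteristic function of a set of numbers. -/
noncomputable def charFun (A : Set ℕ) : ℕ → ℕ := A.indicator 1

/-- The `i`-th component of the sequence of functions coded by `p`. -/
def col (p : ℕ → ℕ) (i : ℕ) : ℕ → ℕ := fun k => p (Nat.pair i k)

/-- `p` codes the vector space `V` over the field `K`, where scalars and vectors are identified
with natural numbers by the injections `eK` and `eV`: the components of `p` are the set of
scalars, the addition, multiplication, zero and one of the field, the set of vectors, and the
addition, scalar multiplication and zero of the vector space. (The values of the operations at
numbers that are not scalars or vectors do not matter.) -/
structure Codes {K V : Type} [Field K] [AddCommGroup V] [Module K V]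
    (p : ℕ → ℕ) (eK : K → ℕ) (eV : V → ℕ) : Prop where
  injective_scalar : Function.Injective eK
  injective_vector : Function.Injective eV
  scalars : col p 0 = charFun (Set.range eK)
  scalar_add : ∀ a b : K, col p 1 (Nat.pair (eK a) (eK b)) = eK (a + b)
  scalar_mul : ∀ a b : K, col p 2 (Nat.pair (eK a) (eK b)) = eK (a * b)
  scalar_zero : col p 3 0 = eK 0
  scalar_one : col p 3 1 = eK 1
  vectors : col p 4 = charFun (Set.range eV)
  vector_add : ∀ v w : V, col p 5 (Nat.pair (eV v) (eV w)) = eV (v + w)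
  vector_smul : ∀ (a : K) (v : V), col p 6 (Nat.pair (eK a) (eV v)) = eV (a • v)
  vector_zero : col p 7 0 = eV 0

/-- The problem of finding a basis for a countable vector space of dimension `n` over (a coded
copy of) the field `K`. Instances are codes of such spaces, solutions are characteristic
functions of bases. -/
def VSBOver (K : Type) [Field K] (n : ℕ) : Set ((ℕ → ℕ) × (ℕ → ℕ)) :=
  {x | ∃ (V : Type) (_ : AddCommGroup V) (_ : Module K V) (eK : K → ℕ) (eV : V → ℕ) (B : Set V),
    Codes x.1 eK eV ∧ Module.rank K V = (n : Cardinal) ∧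
    LinearIndepOn K id B ∧ Submodule.span K B = ⊤ ∧
    x.2 = charFun (eV '' B)}

/-- The problem of finding a basis for a countable vector space of dimension `n` over a countable
field. The field is a part of the instance. -/
def VSB (n : ℕ) : Set ((ℕ → ℕ) × (ℕ → ℕ)) :=
  {x | ∃ (K : Type) (_ : Field K), x ∈ VSBOver K n}

end WR

namespace WR

open Encodable Denumerable

/-! Finding a basis reduces to closed choice because failure to be a basis is visible in a finite
part of the code. In dimension `n`, a list enumerates a basis once it consists of `n` independent
vectors; a wrong length, an entry that is not a vector, or a nontrivial vanishing combination is
eventually seen. So the codes of bad lists can be enumerated, uniformly in the field, and any number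
that is missed codes a basis (`Codes.not_refutes`, `Codes.exists_refutes`,
`exists_functionals_basis`).

Conversely, a copy of `ℚ ^ n` is built in stages from `f`, along with a guess at a number outside
the range of `f`. A vector gets as its number the pair of the current stage and the current guess.
When the guess is seen in the range, the finitely many vectors numbered so far are pushed into the
hyperplane `v 1 = 0` by replacing `(v 0, v 1)` with `(v 0 + N * v 1, 0)`, and the guess advances.
For large `N` this is injective on these vectors; two coordinates are needed here. The moves are
linear, so sums and multiples already announced stay correct and the space is computable from `f`.

The guess never passes a missing number, so it stabilizes at a value `m` outside the range, and in
the limit every vector off the hyperplane carries `m` in its number (`exists_isLimitNumbering`). A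
basis cannot lie in the hyperplane, so `m` is the largest guess in the numbers of its members. The
size `n` of the basis is known, so the characteristic function alone yields `m`
(`exists_functional_sup`). A solution may refer to another field and space with the same code;
`exists_mem_of_span_eq_top` covers this. -/

/-- The sequence of states of a process that starts at `init` and reads the oracle `g`. -/
def run {σ : Type} (init : σ) (step : ℕ → ℕ → σ → σ) (g : ℕ → ℕ) : ℕ → σ
  | 0 => init
  | t + 1 => step t (g t) (run init step g t)

/-! ### Functionals obtained from primitive recursive processes and unbounded search -/

namespace RecursiveFunctional

theorem of_eq {F H : (ℕ → ℕ) → ℕ →. ℕ} (hF : RecursiveFunctional F) (h : ∀ g n, F g n = H g n) :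
    RecursiveFunctional H :=
  (funext₂ h : F = H) ▸ hF

theorem of_partrec {f : ℕ →. ℕ} (hf : Nat.Partrec f) : RecursiveFunctional fun _ => f := by
  induction hf with
  | zero => exact zero
  | succ => exact succ
  | left => exact left
  | right => exact right
  | pair _ _ hf hg => exact hf.pair hg
  | comp _ _ hf hg => exact hf.comp hg
  | prec _ _ hf hg => exact hf.prec hg
  | rfind _ hf => exact hf.rfind

theorem of_primrec {f : ℕ → ℕ} (hf : Primrec f) :
    RecursiveFunctional fun _ n => Part.some (f n) :=
  of_partrec (.of_primrec (Primrec.nat_iff.1 hf))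

theorem comp_total {F : (ℕ → ℕ) → ℕ →. ℕ} {f : (ℕ → ℕ) → ℕ → ℕ} (hF : RecursiveFunctional F)
    (hf : RecursiveFunctional fun g n => Part.some (f g n)) :
    RecursiveFunctional fun g n => F g (f g n) :=
  (hF.comp hf).of_eq fun _ _ => Part.bind_some _ _

theorem pair_total {f h : (ℕ → ℕ) → ℕ → ℕ}
    (hf : RecursiveFunctional fun g n => Part.some (f g n))
    (hh : RecursiveFunctional fun g n => Part.some (h g n)) :
    RecursiveFunctional fun g n => Part.some (Nat.pair (f g n) (h g n)) :=
  (hf.pair hh).of_eq fun _ _ => by simp [Seq.seq]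

theorem run {σ : Type} [Primcodable σ] (init : σ) {step : ℕ → ℕ → σ → σ}
    (hstep : Primrec fun q : ℕ × ℕ × σ => step q.1 q.2.1 q.2.2) :
    RecursiveFunctional fun g t => Part.some (encode (run init step g t)) := by
  -- On options `encode (some x) = encode x + 1`, so subtracting 1 strips the `some`.
  let f : ℕ → ℕ := fun x => encode ((decode (α := ℕ × ℕ × σ) x).map
    fun q => step q.1 q.2.1 q.2.2) - 1
  have hf : Primrec f := Primrec.nat_sub.comp (Primrec.encode.comp
    (Primrec.option_map .decode (hstep.comp .snd).to₂)) (.const 1)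
  have hleft : RecursiveFunctional fun _ n => Part.some n.unpair.1 := left
  have hright : RecursiveFunctional fun _ n => Part.some n.unpair.2 := right
  have hy : RecursiveFunctional fun _ n => Part.some n.unpair.2.unpair.1 := hleft.comp_total hright
  have hi : RecursiveFunctional fun _ n => Part.some n.unpair.2.unpair.2 := hright.comp_total hright
  have step' := (of_primrec hf).comp_total (hy.pair_total ((oracle.comp_total hy).pair_total hi))
  have rec' := (of_primrec (Primrec.const (encode init))).prec step'
  refine (rec'.comp_total ((of_primrec (.const 0)).pair_total (of_primrec .id))).of_eq ?_
  intro g t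
  simp only [Nat.unpair_pair, id]
  induction t with
  | zero => rfl
  | succ t ih =>
    refine (congrArg (fun q : Part ℕ => q.bind _) ih).trans ?_
    simp [f, WR.run]

end RecursiveFunctional

/-- Unbounded search for a stage with `R`. Only the first hit is used, but asking that all hits give
the same output avoids having to know which one comes first. -/
theorem exists_search {σ : Type} [Primcodable σ] (init : σ) {step : ℕ → ℕ → σ → σ}
    (hstep : Primrec fun q : ℕ × ℕ × σ => step q.1 q.2.1 q.2.2) {R : ℕ → ℕ → σ → Prop}
    (hR : PrimrecPred fun q : ℕ × ℕ × σ => R q.1 q.2.1 q.2.2) {out : ℕ → ℕ → σ → ℕ}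
    (hout : Primrec fun q : ℕ × ℕ × σ => out q.1 q.2.1 q.2.2) :
    ∃ F, RecursiveFunctional F ∧ ∀ g k v, (∃ s, R k s (run init step g s)) →
      (∀ s, R k s (run init step g s) → out k s (run init step g s) = v) → v ∈ F g k := by
  classical
  let test : ℕ → ℕ := fun x => encode ((decode (α := ℕ × ℕ × σ) x).map
    fun q => if R q.1 q.2.1 q.2.2 then 0 else 1) - 1
  have htest : Primrec test := Primrec.nat_sub.comp (Primrec.encode.comp
    (Primrec.option_map .decode
      ((Primrec.ite hR (.const 0) (.const 1)).comp .snd).to₂)) (.const 1)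
  let res : ℕ → ℕ := fun x => encode ((decode (α := ℕ × ℕ × σ) x).map
    fun q => out q.1 q.2.1 q.2.2) - 1
  have hres : Primrec res := Primrec.nat_sub.comp (Primrec.encode.comp
    (Primrec.option_map .decode (hout.comp .snd).to₂)) (.const 1)
  have hleft : RecursiveFunctional fun _ n => Part.some n.unpair.1 := .left
  have hright : RecursiveFunctional fun _ n => Part.some n.unpair.2 := .right
  have arg : RecursiveFunctional fun g n => Part.some
      (Nat.pair n.unpair.1 (Nat.pair n.unpair.2 (encode (run init step g n.unpair.2)))) :=
    hleft.pair_total (hright.pair_total ((RecursiveFunctional.run init hstep).comp_total hright))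
  have search := ((RecursiveFunctional.of_primrec htest).comp_total arg).rfind
  refine ⟨_, ((RecursiveFunctional.of_primrec hres).comp_total arg).comp
    ((RecursiveFunctional.of_primrec .id).pair search), ?_⟩
  intro g k v hex hv
  have ht : ∀ s, test (Nat.pair k (Nat.pair s (encode (run init step g s)))) =
      if R k s (run init step g s) then 0 else 1 := fun s => by simp [test]
  have hr : ∀ s, res (Nat.pair k (Nat.pair s (encode (run init step g s)))) =
      out k s (run init step g s) := fun s => by simp [res]
  have hfind : Nat.find hex ∈ Nat.rfind fun n => (fun m => decide (m = 0)) <$>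
      (Part.some (test (Nat.pair k (Nat.pair n (encode (run init step g n))))) : Part ℕ) := by
    refine Nat.mem_rfind.2 ⟨?_, ?_⟩
    · simp [ht, Nat.find_spec hex]
    · intro m hm
      simp [ht, Nat.find_min hex hm]
  simp only [Nat.unpair_pair]
  rw [Part.eq_some_iff.2 hfind]
  simp [Seq.seq, hr, hv _ (Nat.find_spec hex)]

/-- A criterion for strong reducibility in terms of functionals. -/
theorem strongReducible_of {X Y X' Y' : Type} [Named X] [Named Y] [Named X'] [Named Y']
    (hX' : Function.Injective (Named.name : X' → ℕ → ℕ))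
    (hY : Function.Injective (Named.name : Y → ℕ → ℕ))
    {P : Set (X × Y)} {Q : Set (X' × Y')} {F G : (ℕ → ℕ) → ℕ →. ℕ}
    (hF : RecursiveFunctional F) (hG : RecursiveFunctional G)
    (h : ∀ x ∈ dom P, ∃ x', (∀ k, Named.name x' k ∈ F (Named.name x) k) ∧ x' ∈ dom Q ∧
      ∀ r, (x', r) ∈ Q → ∃ s, (∀ k, Named.name s k ∈ G (Named.name r) k) ∧ (x, s) ∈ P) :
    StrongReducible P Q := by
  have key : ∀ {A B : Type} [Named A] [Named B] (E : (ℕ → ℕ) → ℕ →. ℕ),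
      RecursiveFunctional E → Function.Injective (Named.name : B → ℕ → ℕ) →
      ∃ Θ : A →. B, ComputableMap Θ ∧
        ∀ a b, (∀ k, Named.name b k ∈ E (Named.name a) k) → b ∈ Θ a := by
    intro A B _ _ E hE hB
    -- Names determine objects, so the chosen `b` is the only one whose name `E` computes.
    refine ⟨fun a => ⟨∃ b : B, ∀ k, Named.name b k ∈ E (Named.name a) k, fun h => h.choose⟩,
      ⟨E, hE, ?_⟩, ?_⟩
    · rintro a b ⟨hb, rfl⟩
      exact hb.choose_spec
    · intro a b hb
      have hex : ∃ b : B, ∀ k, Named.name b k ∈ E (Named.name a) k := ⟨b, hb⟩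
      exact ⟨hex, hB (funext fun k => Part.mem_unique (hex.choose_spec k) (hb k))⟩
  obtain ⟨Φ, hΦ, hΦ'⟩ := key (A := X) (B := X') F hF hX'
  obtain ⟨Ψ, hΨ, hΨ'⟩ := key (A := Y') (B := Y) G hG hY
  refine ⟨Φ, Ψ, hΦ, hΨ, fun x hx => ?_⟩
  obtain ⟨x', hx', hd, hr⟩ := h x hx
  refine ⟨x', hΦ' x x' hx', hd, fun r hrQ => ?_⟩
  obtain ⟨s, hs, hsP⟩ := hr r hrQ
  exact ⟨s, hΨ' r s hs, hsP⟩

theorem name_injective_fun : Function.Injective (Named.name : (ℕ → ℕ) → ℕ → ℕ) :=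
  fun _ _ h => h

theorem name_injective_nat : Function.Injective (Named.name : ℕ → ℕ → ℕ) :=
  fun _ _ h => congrFun h 0


/-! ### Refuting a proposed basis from a finite part of a code -/

theorem run_append (g : ℕ → ℕ) (s : ℕ) :
    run [] (fun _ a (l : List ℕ) => l ++ [a]) g s = (List.range s).map g := by
  induction s with
  | zero => rfl
  | succ s ih => simp [run, ih, List.range_succ]

theorem getElem?_map_range {g : ℕ → ℕ} {s i v : ℕ} :
    ((List.range s).map g)[i]? = some v ↔ i < s ∧ g i = v := by
  rcases lt_or_ge i s with h | h <;> simp [h]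

theorem eventually_getElem?_map_range (g : ℕ → ℕ) (i : ℕ) :
    ∀ᶠ s in Filter.atTop, ((List.range s).map g)[i]? = some (g i) := by
  filter_upwards [Filter.eventually_gt_atTop i] with s hs
  exact getElem?_map_range.2 ⟨hs, rfl⟩

/-- The value of a linear combination, as far as it can be computed from the initial segment `l`
of a code of a vector space. -/
def comb (l : List ℕ) (w : List (ℕ × ℕ)) : Option ℕ :=
  w.foldr (fun e o => o.bind fun a => (l[Nat.pair 6 (Nat.pair e.1 e.2)]?).bind fun b =>
    l[Nat.pair 5 (Nat.pair b a)]?) l[Nat.pair 7 0]?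

theorem primrec_comb : Primrec₂ comb := by
  have base : Primrec fun q : List ℕ × List (ℕ × ℕ) => q.1[Nat.pair 7 0]? :=
    Primrec.list_getElem?.comp .fst (.const _)
  have mul : Primrec₂ fun (q : ((List ℕ × List (ℕ × ℕ)) × (ℕ × ℕ) × Option ℕ)) (_ : ℕ) =>
      q.1.1[Nat.pair 6 (Nat.pair q.2.1.1 q.2.1.2)]? :=
    Primrec.list_getElem?.comp (.comp .fst (.comp .fst .fst))
      (Primrec₂.natPair.comp (.const 6) (Primrec₂.natPair.comp
        (.comp .fst (.comp .fst (.comp .snd .fst))) (.comp .snd (.comp .fst (.comp .snd .fst)))))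
  have add : Primrec₂ fun (q : ((List ℕ × List (ℕ × ℕ)) × (ℕ × ℕ) × Option ℕ) × ℕ) (b : ℕ) =>
      q.1.1.1[Nat.pair 5 (Nat.pair b q.2)]? :=
    Primrec.list_getElem?.comp (.comp .fst (.comp .fst (.comp .fst .fst)))
      (Primrec₂.natPair.comp (.const 5) (Primrec₂.natPair.comp .snd (.comp .snd .fst)))
  exact Primrec.list_foldr .snd base
    (Primrec.option_bind (.comp .snd .snd) (Primrec.option_bind mul add).to₂).to₂

/-- The initial segment `l` of a code of a vector space and the linear combination `w` show that
`vs` does not enumerate a basis. -/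
def Refutes (n : ℕ) (l vs : List ℕ) (w : List (ℕ × ℕ)) : Prop :=
  vs.length ≠ n ∨ (∃ v ∈ vs, l[Nat.pair 4 v]? = some 0) ∨
    (w.map Prod.snd = vs ∧ Nat.pair 3 0 < l.length ∧ (∀ e ∈ w, l[Nat.pair 0 e.1]? = some 1) ∧
      (∃ e ∈ w, l[Nat.pair 3 0]? ≠ some e.1) ∧ (comb l w).isSome = true ∧
      comb l w = l[Nat.pair 7 0]?)

theorem primrecPred_refutes (n : ℕ) :
    PrimrecPred fun q : List ℕ × List ℕ × List (ℕ × ℕ) => Refutes n q.1 q.2.1 q.2.2 := by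
  have hl : Primrec fun q : List ℕ × List ℕ × List (ℕ × ℕ) => q.1 := .fst
  have hvs : Primrec fun q : List ℕ × List ℕ × List (ℕ × ℕ) => q.2.1 := .comp .fst .snd
  have hw : Primrec fun q : List ℕ × List ℕ × List (ℕ × ℕ) => q.2.2 := .comp .snd .snd
  have hc := primrec_comb.comp hl hw
  have h4 : PrimrecRel fun (v : ℕ) (l : List ℕ) => l[Nat.pair 4 v]? = some 0 :=
    Primrec.eq.comp (Primrec.list_getElem?.comp .snd (Primrec₂.natPair.comp (.const 4) .fst))
      (.const _)
  have h0 : PrimrecRel fun (e : ℕ × ℕ) (l : List ℕ) => l[Nat.pair 0 e.1]? = some 1 :=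
    Primrec.eq.comp (Primrec.list_getElem?.comp .snd
      (Primrec₂.natPair.comp (.const 0) (.comp .fst .fst))) (.const _)
  have h3 : PrimrecRel fun (e : ℕ × ℕ) (l : List ℕ) => l[Nat.pair 3 0]? ≠ some e.1 :=
    PrimrecPred.not (Primrec.eq.comp (Primrec.list_getElem?.comp .snd (.const _))
      (Primrec.option_some.comp (.comp .fst .fst)))
  refine .or (.not (Primrec.eq.comp (Primrec.list_length.comp hvs) (.const n)))
    (.or (h4.exists_mem_list.comp hvs hl) (.and (Primrec.eq.comp
      (Primrec.list_map hw (Primrec.comp₂ .snd .right)) hvs) (.and ?_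
      (.and (h0.forall_mem_list.comp hw hl) (.and (h3.exists_mem_list.comp hw hl) (.and ?_ ?_))))))
  · exact Primrec.nat_lt.comp (.const _) (Primrec.list_length.comp hl)
  · exact Primrec.eq.comp (Primrec.option_isSome.comp hc) (.const _)
  · exact Primrec.eq.comp hc (Primrec.list_getElem?.comp hl (.const _))

section Codes

variable {K V : Type} [Field K] [AddCommGroup V] [Module K V] {p : ℕ → ℕ} {eK : K → ℕ} {eV : V → ℕ}

/-- Soundness: a finite part of the code may leave the combination undefined but never gives a wrong
value. `Codes.eventually_comb` is the matching completeness. -/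
theorem Codes.comb_eq (h : Codes p eK eV) (s : ℕ) (w : List (K × V)) {x : ℕ}
    (hx : comb ((List.range s).map p) (w.map fun e => (eK e.1, eV e.2)) = some x) :
    x = eV (w.map fun e => e.1 • e.2).sum := by
  induction w generalizing x with
  | nil =>
    rw [List.map_nil, comb, List.foldr_nil, getElem?_map_range] at hx
    exact hx.2.symm.trans h.vector_zero
  | cons e w ih =>
    simp only [List.map_cons, comb, List.foldr_cons, Option.bind_eq_some_iff,
      getElem?_map_range] at hx
    obtain ⟨a, ha, b, ⟨-, hb⟩, -, hx⟩ := hx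
    have ha := ih ha
    have hb' : b = eV (e.1 • e.2) := hb.symm.trans (h.vector_smul _ _)
    subst ha hb'
    rw [List.map_cons, List.sum_cons, ← hx]
    exact h.vector_add _ _

theorem Codes.eventually_comb (h : Codes p eK eV) (w : List (K × V)) :
    ∀ᶠ s in Filter.atTop, comb ((List.range s).map p) (w.map fun e => (eK e.1, eV e.2)) =
      some (eV (w.map fun e => e.1 • e.2).sum) := by
  induction w with
  | nil =>
    filter_upwards [eventually_getElem?_map_range p (Nat.pair 7 0)] with s hs
    exact hs.trans (congrArg some h.vector_zero)
  | cons e w ih =>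
    filter_upwards [ih, eventually_getElem?_map_range p (Nat.pair 6 (Nat.pair (eK e.1) (eV e.2))),
      eventually_getElem?_map_range p (Nat.pair 5 (Nat.pair (eV (e.1 • e.2))
        (eV (w.map fun e => e.1 • e.2).sum)))] with s h0 h1 h2
    have e6 : p (Nat.pair 6 (Nat.pair (eK e.1) (eV e.2))) = eV (e.1 • e.2) := h.vector_smul _ _
    have e5 : p (Nat.pair 5 (Nat.pair (eV (e.1 • e.2)) (eV (w.map fun e => e.1 • e.2).sum))) =
      eV (e.1 • e.2 + (w.map fun e => e.1 • e.2).sum) := h.vector_add _ _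
    rw [e6] at h1
    rw [e5] at h2
    rw [comb] at h0
    simp only [List.map_cons, comb, List.foldr_cons, h0, Option.bind_some, h1, h2, List.sum_cons]

theorem Codes.col_four_eq_zero (h : Codes p eK eV) {x : ℕ} :
    p (Nat.pair 4 x) = 0 ↔ x ∉ Set.range eV := by
  have : p (Nat.pair 4 x) = charFun (Set.range eV) x := congrFun h.vectors x
  rw [this, charFun]
  by_cases hx : x ∈ Set.range eV <;> simp [Set.indicator, hx]

theorem Codes.col_zero_eq_one (h : Codes p eK eV) {x : ℕ} :
    p (Nat.pair 0 x) = 1 ↔ x ∈ Set.range eK := by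
  have : p (Nat.pair 0 x) = charFun (Set.range eK) x := congrFun h.scalars x
  rw [this, charFun]
  by_cases hx : x ∈ Set.range eK <;> simp [Set.indicator, hx]

/-- A list of `n` linearly independent vectors is never refuted. -/
theorem Codes.not_refutes (h : Codes p eK eV) {n : ℕ} {u : Fin n → V}
    (hu : LinearIndependent K u) (s : ℕ) (w : List (ℕ × ℕ)) :
    ¬ Refutes n ((List.range s).map p) (List.ofFn fun i => eV (u i)) w := by
  rintro (hn | ⟨v, hv, hv0⟩ | ⟨hw, h3, h0, hne, hsome, heq⟩)
  · simp at hn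
  · obtain ⟨i, rfl⟩ := List.mem_ofFn.1 hv
    exact h.col_four_eq_zero.1 (getElem?_map_range.1 hv0).2 ⟨_, rfl⟩
  · have hlen : w.length = n := by simpa using congrArg List.length hw
    obtain ⟨a, rfl⟩ : ∃ a : Fin n → ℕ × ℕ, w = List.ofFn a := by
      subst hlen
      exact ⟨w.get, (List.ofFn_get w).symm⟩
    rw [List.map_ofFn] at hw
    have ha2 : ∀ i, (a i).2 = eV (u i) := fun i => congrFun (List.ofFn_injective hw) i
    have ha1 : ∀ i, ∃ c, eK c = (a i).1 := fun i =>
      h.col_zero_eq_one.1 (getElem?_map_range.1 (h0 (a i) (List.mem_ofFn.2 ⟨i, rfl⟩))).2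
    choose c hc using ha1
    have hwa : List.ofFn a = (List.ofFn fun i => (c i, u i)).map fun e => (eK e.1, eV e.2) := by
      rw [List.map_ofFn]
      congr 1
      funext i
      exact Prod.ext (hc i).symm (ha2 i)
    obtain ⟨x, hx⟩ := Option.isSome_iff_exists.1 hsome
    rw [hx, eq_comm, getElem?_map_range] at heq
    rw [hwa] at hx
    have hx' := h.comb_eq s _ hx
    have hx0 : x = eV 0 := heq.2.symm.trans h.vector_zero
    have hsum := h.injective_vector (hx'.symm.trans hx0)
    rw [List.map_ofFn, List.sum_ofFn] at hsum
    obtain ⟨e, he, hne⟩ := hne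
    obtain ⟨i, rfl⟩ := List.mem_ofFn.1 he
    -- The length condition in `Refutes` matters here: an entry not yet read would be `none`, which
    -- differs from every coefficient, even zero.
    refine hne (getElem?_map_range.2 ⟨by simpa using h3, ?_⟩)
    rw [← hc i, Fintype.linearIndependent_iff.1 hu c hsum i]
    exact h.scalar_zero

/-- A list that does not consist of `n` linearly independent vectors is eventually refuted. -/
theorem Codes.exists_refutes (h : Codes p eK eV) {n : ℕ} {vs : List ℕ}
    (hvs : ∀ u : Fin n → V, LinearIndependent K u → vs ≠ List.ofFn fun i => eV (u i)) :
    ∃ w, ∀ᶠ s in Filter.atTop, Refutes n ((List.range s).map p) vs w := by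
  by_cases hlen : vs.length = n
  swap
  · exact ⟨[], .of_forall fun _ => .inl hlen⟩
  by_cases hV : ∃ v ∈ vs, v ∉ Set.range eV
  · obtain ⟨v, hv, hvV⟩ := hV
    refine ⟨[], ?_⟩
    filter_upwards [eventually_getElem?_map_range p (Nat.pair 4 v)] with s hs
    rw [h.col_four_eq_zero.2 hvV] at hs
    exact .inr (.inl ⟨v, hv, hs⟩)
  push Not at hV
  obtain ⟨a, rfl⟩ : ∃ a : Fin n → ℕ, vs = List.ofFn a := by
    subst hlen
    exact ⟨vs.get, (List.ofFn_get vs).symm⟩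
  have ha : ∀ i, ∃ v, eV v = a i := fun i => hV _ (List.mem_ofFn.2 ⟨i, rfl⟩)
  choose u hu using ha
  obtain rfl : (fun i => eV (u i)) = a := funext hu
  have hdep : ¬ LinearIndependent K u := fun hi => hvs u hi rfl
  obtain ⟨c, hsum, i, hi⟩ := Fintype.not_linearIndependent_iff.1 hdep
  let w : List (K × V) := List.ofFn fun i => (c i, u i)
  have hws : (w.map fun e => e.1 • e.2).sum = 0 := by
    rw [List.map_ofFn, List.sum_ofFn]
    exact hsum
  have hmem : ∀ i, (eK (c i), eV (u i)) ∈ w.map fun e => (eK e.1, eV e.2) := fun i =>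
    List.mem_map.2 ⟨(c i, u i), List.mem_ofFn.2 ⟨i, rfl⟩, rfl⟩
  refine ⟨w.map fun e => (eK e.1, eV e.2), ?_⟩
  have hK : ∀ᶠ s in Filter.atTop, ∀ i,
      ((List.range s).map p)[Nat.pair 0 (eK (c i))]? = some 1 := by
    refine Filter.eventually_all.2 fun i => ?_
    filter_upwards [eventually_getElem?_map_range p (Nat.pair 0 (eK (c i)))] with s hs
    rwa [h.col_zero_eq_one.2 ⟨_, rfl⟩] at hs
  filter_upwards [h.eventually_comb w, hK, eventually_getElem?_map_range p (Nat.pair 3 0),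
    eventually_getElem?_map_range p (Nat.pair 7 0)] with s h1 h2 h3 h7
  refine .inr (.inr ⟨?_, ?_, ?_, ⟨_, hmem i, ?_⟩, ?_, ?_⟩)
  · simp only [w, List.map_ofFn]
    rfl
  · simpa using (getElem?_map_range.1 h3).1
  · intro e he
    simp only [w, List.map_ofFn, List.mem_ofFn] at he
    obtain ⟨j, rfl⟩ := he
    exact h2 j
  · rw [h3]
    intro hc
    have hc : p (Nat.pair 3 0) = eK (c i) := Option.some.inj hc
    exact hi (h.injective_scalar (hc.symm.trans h.scalar_zero))
  · simp [h1]
  · rw [h1, h7, hws]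
    exact congrArg some h.vector_zero.symm

/-- In dimension `n`, spanning is automatic for `n` independent vectors, so only independence has to
be tested. -/
theorem Codes.mem_VSBOver (h : Codes p eK eV) {n : ℕ} (hr : Module.rank K V = (n : Cardinal))
    {u : Fin n → V} (hu : LinearIndependent K u) :
    (p, charFun {x | x ∈ List.ofFn fun i => eV (u i)}) ∈ VSBOver K n := by
  refine ⟨V, _, _, eK, eV, Set.range u, h, hr, hu.linearIndepOn_id, ?_, ?_⟩
  · have := Module.finite_of_rank_eq_nat hr
    exact hu.span_eq_top_of_card_eq_finrank' (by simp [Module.finrank_eq_of_rank_eq hr])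
  · change charFun _ = charFun _
    congr 1
    ext x
    simp

end Codes

/-! ### Finding a basis reduces to closed choice -/

/-- The functionals that reduce the problem of finding a basis to closed choice do not depend on
the field. -/
theorem exists_functionals_basis (n : ℕ) (hn : n ≠ 0) :
    ∃ F G : (ℕ → ℕ) → ℕ →. ℕ, RecursiveFunctional F ∧ RecursiveFunctional G ∧
      ∀ (K : Type) [Field K], ∀ p ∈ dom (VSBOver K n), ∃ f : ℕ → ℕ, (∀ k, f k ∈ F p k) ∧
        f ∈ dom CN ∧ ∀ m, m ∉ Set.range f →
          ∃ b : ℕ → ℕ, (∀ k, b k ∈ G (fun _ => m) k) ∧ (p, b) ∈ VSBOver K n := by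
  classical
  -- An argument `k` encodes a list, a padding number and a combination. The padding makes `k` large
  -- enough for the first `k` values of the code to contain the refutation.
  let cert : ℕ → List (ℕ × ℕ) := fun k => ofNat _ k.unpair.2.unpair.2
  let out : ℕ → List ℕ → ℕ := fun k l =>
    if Refutes n l (ofNat (List ℕ) k.unpair.1) (cert k) then k.unpair.1 else 0
  have hout : Primrec fun q : ℕ × ℕ × List ℕ => out q.1 q.2.2 := by
    have h1 : Primrec fun q : ℕ × ℕ × List ℕ => q.1.unpair.1 :=
      .comp .fst (.comp .unpair .fst)
    have h2 : Primrec fun q : ℕ × ℕ × List ℕ => q.1.unpair.2.unpair.2 :=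
      .comp .snd (.comp .unpair (.comp .snd (.comp .unpair .fst)))
    exact Primrec.ite ((primrecPred_refutes n).comp (.pair (.comp .snd .snd)
      (.pair (.comp (.ofNat _) h1) (.comp (.ofNat _) h2)))) h1 (.const 0)
  obtain ⟨F, hF, hF'⟩ := exists_search (σ := List ℕ) [] (step := fun _ a l => l ++ [a])
    (Primrec.list_concat.comp (.comp .snd .snd) (.comp .fst .snd))
    (R := fun k s _ => s = k) (Primrec.eq.comp (.comp .fst .snd) .fst)
    (out := fun k _ l => out k l) hout
  obtain ⟨G, hG, hG'⟩ := exists_search (σ := ℕ) 0 (step := fun _ a _ => a)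
    (.comp .fst .snd) (R := fun _ s _ => 0 < s)
    (Primrec.nat_lt.comp (.const 0) (.comp .fst .snd))
    (out := fun k _ m => if (ofNat (List ℕ) m).idxOf k < (ofNat (List ℕ) m).length then 1 else 0)
    (Primrec.ite (Primrec.nat_lt.comp
      (Primrec.list_idxOf.comp .fst (.comp (.ofNat _) (.comp .snd .snd)))
      (.comp .list_length (.comp (.ofNat _) (.comp .snd .snd)))) (.const 1) (.const 0))
  refine ⟨F, G, hF, hG, ?_⟩
  rintro K _ p ⟨r, V, _, _, eK, eV, B, hp, hr, -, -, -⟩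
  let f : ℕ → ℕ := fun k => out k ((List.range k).map p)
  refine ⟨f, ?_, ?_, ?_⟩
  · intro k
    refine hF' p k _ ⟨k, rfl⟩ ?_
    rintro s rfl
    rw [run_append]
  · have := Module.finite_of_rank_eq_nat hr
    let u := Module.finBasisOfFinrankEq K V (Module.finrank_eq_of_rank_eq hr)
    refine ⟨encode (List.ofFn fun i => eV (u i)), ?_⟩
    rintro ⟨k, hk⟩
    change f k = encode (List.ofFn fun i => eV (u i)) at hk
    by_cases hc : Refutes n ((List.range k).map p) (ofNat (List ℕ) k.unpair.1) (cert k)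
    · rw [show f k = k.unpair.1 from if_pos hc] at hk
      rw [hk, ofNat_encode] at hc
      exact hp.not_refutes u.linearIndependent _ _ hc
    -- The default value 0 decodes to the empty list, which is harmless because `n ≠ 0`.
    · rw [show f k = 0 from if_neg hc] at hk
      have h0 := congrArg (fun x => (ofNat (List ℕ) x).length) hk
      simp only [ofNat_encode, List.length_ofFn] at h0
      exact hn (h0.symm.trans (by simp))
  · intro m hm
    obtain ⟨u, hu, hmu⟩ : ∃ u : Fin n → V, LinearIndependent K u ∧
        ofNat (List ℕ) m = List.ofFn fun i => eV (u i) := by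
      by_contra! hcon
      obtain ⟨w, hw⟩ := hp.exists_refutes hcon
      obtain ⟨s, hs⟩ := Filter.eventually_atTop.1 hw
      refine hm ⟨Nat.pair m (Nat.pair s (encode w)), ?_⟩
      have hle : s ≤ Nat.pair m (Nat.pair s (encode w)) :=
        (Nat.left_le_pair _ _).trans (Nat.right_le_pair _ _)
      have := hs _ hle
      simp [f, out, cert, this]
    refine ⟨_, ?_, hp.mem_VSBOver hr hu⟩
    rw [← hmu]
    intro k
    refine hG' _ k _ ⟨1, one_pos⟩ ?_
    intro s hs
    obtain ⟨s, rfl⟩ := Nat.exists_eq_add_one.2 hs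
    simp [run, charFun, Set.indicator, List.idxOf_lt_length_iff]

theorem VSBOver_strongReducible_CN (K : Type) [Field K] (n : ℕ) (hn : n ≠ 0) :
    StrongReducible (VSBOver K n) CN := by
  obtain ⟨F, G, hF, hG, h⟩ := exists_functionals_basis n hn
  exact strongReducible_of name_injective_fun name_injective_fun hF hG (h K)

theorem VSB_strongReducible_CN (n : ℕ) (hn : n ≠ 0) : StrongReducible (VSB n) CN := by
  obtain ⟨F, G, hF, hG, h⟩ := exists_functionals_basis n hn
  refine strongReducible_of name_injective_fun name_injective_fun hF hG ?_
  rintro p ⟨r, K, _, hp⟩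
  obtain ⟨f, hf, hd, hr⟩ := h K p ⟨r, hp⟩
  refine ⟨f, hf, hd, fun m hm => ?_⟩
  obtain ⟨b, hb, hs⟩ := hr m hm
  exact ⟨b, hb, K, _, hs⟩


/-! ### Closure properties of primitive recursive predicates -/

theorem primrecPred_true {α : Type} [Primcodable α] : PrimrecPred fun _ : α => True :=
  (Primrec.eq.comp (.const 0) (.const 0)).of_eq fun _ => by simp

theorem primrecPred_forall_fin {α : Type} [Primcodable α] {n : ℕ} {R : Fin n → α → Prop}
    (hR : ∀ i, PrimrecPred (R i)) : PrimrecPred fun a => ∀ i, R i a := by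
  induction n with
  | zero => exact primrecPred_true.of_eq fun _ => by simp
  | succ n ih =>
    exact ((hR 0).and (ih fun i => hR i.succ)).of_eq fun a =>
      (Fin.forall_fin_succ (P := fun i => R i a)).symm

theorem primrecPred_exists_mem {α β : Type} [Primcodable α] [Primcodable β] {l : α → List β}
    {R : α → β → Prop} (hl : Primrec l) (hR : PrimrecRel R) :
    PrimrecPred fun a => ∃ b ∈ l a, R a b :=
  hR.swap.exists_mem_list.comp hl .id

theorem primrecPred_mem {α β : Type} [Primcodable α] [Primcodable β] {f : α → β}
    {l : α → List β} (hf : Primrec f) (hl : Primrec l) : PrimrecPred fun a => f a ∈ l a :=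
  (primrecPred_exists_mem (R := fun a b => b = f a) hl
    (Primrec.eq.comp .snd (.comp hf .fst))).of_eq fun a => by simp

theorem primrecPred_forall_mem {α β : Type} [Primcodable α] [Primcodable β] {l : α → List β}
    {R : α → β → Prop} (hl : Primrec l) (hR : PrimrecRel R) :
    PrimrecPred fun a => ∀ b ∈ l a, R a b :=
  hR.swap.forall_mem_list.comp hl .id

theorem primrecPred_imp {α : Type} [Primcodable α] {P Q : α → Prop} (hP : PrimrecPred P)
    (hQ : PrimrecPred Q) : PrimrecPred fun a => P a → Q a :=
  (hP.not.or hQ).of_eq fun _ => imp_iff_not_or.symm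

theorem primrec_unpair_fst {α : Type} [Primcodable α] {f : α → ℕ} (hf : Primrec f) :
    Primrec fun a => (f a).unpair.1 :=
  .comp .fst (.comp .unpair hf)

theorem primrec_unpair_snd {α : Type} [Primcodable α] {f : α → ℕ} (hf : Primrec f) :
    Primrec fun a => (f a).unpair.2 :=
  .comp .snd (.comp .unpair hf)

theorem primrec_add {α : Type} [Primcodable α] {f g : α → ℕ} (hf : Primrec f) (hg : Primrec g) :
    Primrec fun a => f a + g a :=
  Primrec.nat_add.comp hf hg

theorem primrec_mul {α : Type} [Primcodable α] {f g : α → ℕ} (hf : Primrec f) (hg : Primrec g) :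
    Primrec fun a => f a * g a :=
  Primrec.nat_mul.comp hf hg

/-! ### Codes of rational numbers -/

/-- The rational number with the code `x`. Every rational number has infinitely many codes. -/
def rat (x : ℕ) : ℚ := (x.unpair.1 - x.unpair.2.unpair.1) / (x.unpair.2.unpair.2 + 1)

theorem rat_pair (a b c : ℕ) : rat (Nat.pair a (Nat.pair b c)) = (a - b) / (c + 1) := by
  simp [rat]

theorem rat_natCast (a : ℕ) : rat (Nat.pair a 0) = a := by
  simp [rat]

theorem rat_zero : rat 0 = 0 := by
  simp [rat]

theorem rat_surjective : Function.Surjective rat := by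
  intro q
  -- Positive and negative part of the numerator, and the denominator less one.
  refine ⟨Nat.pair q.num.toNat (Nat.pair (-q.num).toNat (q.den - 1)), ?_⟩
  rw [rat_pair]
  have h1 : ((q.num.toNat : ℤ) - ((-q.num).toNat : ℤ)) = q.num := by omega
  have h2 : ((q.num.toNat : ℚ) - ((-q.num).toNat : ℚ)) = q.num := by exact_mod_cast h1
  have h3 : (((q.den - 1 : ℕ) : ℚ) + 1) = q.den := by
    exact_mod_cast Nat.sub_add_cancel q.den_pos
  rw [h2, h3, Rat.num_div_den]

/-- A code of the sum of the rational numbers with the codes `x` and `y`. -/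
def addCode (x y : ℕ) : ℕ :=
  Nat.pair (x.unpair.1 * (y.unpair.2.unpair.2 + 1) + y.unpair.1 * (x.unpair.2.unpair.2 + 1))
    (Nat.pair (x.unpair.2.unpair.1 * (y.unpair.2.unpair.2 + 1) +
      y.unpair.2.unpair.1 * (x.unpair.2.unpair.2 + 1))
      (x.unpair.2.unpair.2 * y.unpair.2.unpair.2 + x.unpair.2.unpair.2 + y.unpair.2.unpair.2))

/-- A code of the product of the rational numbers with the codes `x` and `y`. -/
def mulCode (x y : ℕ) : ℕ :=
  Nat.pair (x.unpair.1 * y.unpair.1 + x.unpair.2.unpair.1 * y.unpair.2.unpair.1)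
    (Nat.pair (x.unpair.1 * y.unpair.2.unpair.1 + x.unpair.2.unpair.1 * y.unpair.1)
      (x.unpair.2.unpair.2 * y.unpair.2.unpair.2 + x.unpair.2.unpair.2 + y.unpair.2.unpair.2))

theorem rat_addCode (x y : ℕ) : rat (addCode x y) = rat x + rat y := by
  rw [addCode, rat_pair, rat, rat]
  have h1 : ((x.unpair.2.unpair.2 : ℚ) + 1) ≠ 0 := by positivity
  have h2 : ((y.unpair.2.unpair.2 : ℚ) + 1) ≠ 0 := by positivity
  rw [div_add_div _ _ h1 h2]
  push_cast
  congr 1 <;> ring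

theorem rat_mulCode (x y : ℕ) : rat (mulCode x y) = rat x * rat y := by
  rw [mulCode, rat_pair, rat, rat, div_mul_div_comm]
  push_cast
  congr 1 <;> ring

theorem primrec_addCode : Primrec₂ addCode := by
  have x1 : Primrec fun q : ℕ × ℕ => q.1.unpair.1 := primrec_unpair_fst .fst
  have y1 : Primrec fun q : ℕ × ℕ => q.2.unpair.1 := primrec_unpair_fst .snd
  have x2 : Primrec fun q : ℕ × ℕ => q.1.unpair.2.unpair.1 :=
    primrec_unpair_fst (primrec_unpair_snd .fst)
  have y2 : Primrec fun q : ℕ × ℕ => q.2.unpair.2.unpair.1 :=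
    primrec_unpair_fst (primrec_unpair_snd .snd)
  have x3 : Primrec fun q : ℕ × ℕ => q.1.unpair.2.unpair.2 :=
    primrec_unpair_snd (primrec_unpair_snd .fst)
  have y3 : Primrec fun q : ℕ × ℕ => q.2.unpair.2.unpair.2 :=
    primrec_unpair_snd (primrec_unpair_snd .snd)
  have x4 := primrec_add x3 (.const 1)
  have y4 := primrec_add y3 (.const 1)
  exact Primrec₂.natPair.comp (primrec_add (primrec_mul x1 y4) (primrec_mul y1 x4))
    (Primrec₂.natPair.comp (primrec_add (primrec_mul x2 y4) (primrec_mul y2 x4))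
      (primrec_add (primrec_add (primrec_mul x3 y3) x3) y3))

theorem primrec_mulCode : Primrec₂ mulCode := by
  have x1 : Primrec fun q : ℕ × ℕ => q.1.unpair.1 := primrec_unpair_fst .fst
  have y1 : Primrec fun q : ℕ × ℕ => q.2.unpair.1 := primrec_unpair_fst .snd
  have x2 : Primrec fun q : ℕ × ℕ => q.1.unpair.2.unpair.1 :=
    primrec_unpair_fst (primrec_unpair_snd .fst)
  have y2 : Primrec fun q : ℕ × ℕ => q.2.unpair.2.unpair.1 :=
    primrec_unpair_fst (primrec_unpair_snd .snd)
  have x3 : Primrec fun q : ℕ × ℕ => q.1.unpair.2.unpair.2 :=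
    primrec_unpair_snd (primrec_unpair_snd .fst)
  have y3 : Primrec fun q : ℕ × ℕ => q.2.unpair.2.unpair.2 :=
    primrec_unpair_snd (primrec_unpair_snd .snd)
  exact Primrec₂.natPair.comp (primrec_add (primrec_mul x1 y1) (primrec_mul x2 y2))
    (Primrec₂.natPair.comp (primrec_add (primrec_mul x1 y2) (primrec_mul x2 y1))
      (primrec_add (primrec_add (primrec_mul x3 y3) x3) y3))

theorem primrecRel_rat_eq : PrimrecRel fun x y => rat x = rat y := by
  have x1 : Primrec fun q : ℕ × ℕ => q.1.unpair.1 := primrec_unpair_fst .fst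
  have y1 : Primrec fun q : ℕ × ℕ => q.2.unpair.1 := primrec_unpair_fst .snd
  have x2 : Primrec fun q : ℕ × ℕ => q.1.unpair.2.unpair.1 :=
    primrec_unpair_fst (primrec_unpair_snd .fst)
  have y2 : Primrec fun q : ℕ × ℕ => q.2.unpair.2.unpair.1 :=
    primrec_unpair_fst (primrec_unpair_snd .snd)
  have x3 : Primrec fun q : ℕ × ℕ => q.1.unpair.2.unpair.2 :=
    primrec_unpair_snd (primrec_unpair_snd .fst)
  have y3 : Primrec fun q : ℕ × ℕ => q.2.unpair.2.unpair.2 :=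
    primrec_unpair_snd (primrec_unpair_snd .snd)
  have x4 := primrec_add x3 (.const 1)
  have y4 := primrec_add y3 (.const 1)
  -- Cross-multiplied, with the subtracted terms moved to the other side to stay in `ℕ`.
  refine PrimrecPred.of_eq (Primrec.eq.comp (primrec_add (primrec_mul x1 y4) (primrec_mul y2 x4))
    (primrec_add (primrec_mul y1 x4) (primrec_mul x2 y4))) ?_
  rintro ⟨x, y⟩
  change _ ↔ rat x = rat y
  have h1 : ((x.unpair.2.unpair.2 : ℚ) + 1) ≠ 0 := by positivity
  have h2 : ((y.unpair.2.unpair.2 : ℚ) + 1) ≠ 0 := by positivity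
  rw [rat, rat, div_eq_div_iff h1 h2, ← @Nat.cast_inj ℚ]
  push_cast
  constructor <;> intro h <;> linarith

/-- `x` is the least code of a rational number. -/
def IsLeastCode (x : ℕ) : Prop := ∀ y < x, rat y ≠ rat x

theorem primrecPred_isLeastCode : PrimrecPred IsLeastCode :=
  (primrecRel_rat_eq.not.forall_lt).comp .id .id

open Classical in
/-- The least code of a rational number. -/
noncomputable def ratCode (q : ℚ) : ℕ := Nat.find (rat_surjective q)

theorem rat_ratCode (q : ℚ) : rat (ratCode q) = q := by
  classical exact Nat.find_spec (rat_surjective q)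

theorem ratCode_injective : Function.Injective ratCode :=
  Function.LeftInverse.injective rat_ratCode

theorem isLeastCode_ratCode (q : ℚ) : IsLeastCode (ratCode q) := by
  classical
  intro y hy
  rw [rat_ratCode]
  exact Nat.find_min (rat_surjective q) hy

theorem IsLeastCode.eq_ratCode {x : ℕ} (hx : IsLeastCode x) : x = ratCode (rat x) := by
  classical
  refine le_antisymm (not_lt.1 fun h => hx _ h (rat_ratCode _)) ?_
  exact Nat.find_min' (rat_surjective (rat x)) rfl

theorem mem_range_ratCode {x : ℕ} : x ∈ Set.range ratCode ↔ IsLeastCode x :=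
  ⟨by rintro ⟨q, rfl⟩; exact isLeastCode_ratCode q, fun h => ⟨_, h.eq_ratCode.symm⟩⟩

variable {d : ℕ}

/-! ### Coded vectors and the collapse onto a hyperplane -/

/-- The vector whose coordinates have the codes `c i`. -/
def vec {n : ℕ} (c : Fin n → ℕ) : Fin n → ℚ := fun i => rat (c i)

theorem vec_surjective {n : ℕ} : Function.Surjective (vec (n := n)) := fun v =>
  ⟨fun i => ratCode (v i), funext fun _ => rat_ratCode _⟩

theorem primrecRel_vec_eq {n : ℕ} : PrimrecRel fun c c' : Fin n → ℕ => vec c = vec c' :=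
  (primrecPred_forall_fin fun i => primrecRel_rat_eq.comp
    (Primrec.fin_app.comp .fst (.const i)) (Primrec.fin_app.comp .snd (.const i))).of_eq
    fun _ => funext_iff.symm

/-- A linear map onto the hyperplane `v 1 = 0`. -/
def collapse (d N : ℕ) : (Fin (d + 2) → ℚ) →ₗ[ℚ] (Fin (d + 2) → ℚ) where
  toFun v i := if i = 0 then v 0 + N * v 1 else if i = 1 then 0 else v i
  map_add' v w := by
    ext i
    simp only [Pi.add_apply]
    split_ifs <;> ring
  map_smul' a v := by
    ext i
    simp only [Pi.smul_apply, smul_eq_mul, RingHom.id_apply]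
    split_ifs <;> ring

/-- The map `collapse` on codes. -/
def collapseCode (N : ℕ) (c : Fin (d + 2) → ℕ) : Fin (d + 2) → ℕ := fun i =>
  if i = 0 then addCode (c 0) (mulCode (Nat.pair N 0) (c 1)) else if i = 1 then 0 else c i

theorem vec_collapseCode (N : ℕ) (c : Fin (d + 2) → ℕ) :
    vec (collapseCode N c) = collapse d N (vec c) := by
  ext i
  simp only [vec, collapseCode, collapse, LinearMap.coe_mk, AddHom.coe_mk]
  split_ifs
  · rw [rat_addCode, rat_mulCode, rat_natCast]
  · exact rat_zero
  · rfl

theorem primrec_collapseCode :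
    Primrec₂ (collapseCode : ℕ → (Fin (d + 2) → ℕ) → Fin (d + 2) → ℕ) := by
  refine Primrec.fin_curry.2 ?_
  have app (i : Fin (d + 2)) : Primrec fun q : (ℕ × (Fin (d + 2) → ℕ)) × Fin (d + 2) => q.1.2 i :=
    Primrec.fin_app.comp (.comp .snd .fst) (.const i)
  exact Primrec.ite (Primrec.eq.comp .snd (.const 0))
    (primrec_addCode.comp (app 0) (primrec_mulCode.comp
      (Primrec₂.natPair.comp (.comp .fst .fst) (.const 0)) (app 1)))
    (Primrec.ite (Primrec.eq.comp .snd (.const 1)) (.const 0)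
      (Primrec.fin_app.comp (.comp .snd .fst) .snd))

theorem collapse_apply_one (N : ℕ) (v : Fin (d + 2) → ℚ) : collapse d N v 1 = 0 := by
  simp [collapse]

/-- If `v 1 ≠ w 1`, the images agree for at most one `N`, the quotient `(w 0 - v 0) / (v 1 - w 1)`.
If `v 1 = w 1`, equal images force `v = w` for every `N`. -/
theorem eventually_collapse_injective (v w : Fin (d + 2) → ℚ) :
    ∀ᶠ N in Filter.atTop, collapse d N v = collapse d N w → v = w := by
  have hlarge : ∀ᶠ N : ℕ in Filter.atTop, (w 0 - v 0) / (v 1 - w 1) < (N : ℚ) :=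
    tendsto_natCast_atTop_atTop.eventually_gt_atTop _
  filter_upwards [hlarge] with N hN h
  have h0 : v 0 + N * v 1 = w 0 + N * w 1 := by simpa [collapse] using congrFun h 0
  have h1 : v 1 = w 1 := by
    by_contra hne
    have hne := sub_ne_zero.2 hne
    refine hN.ne ?_
    rw [div_eq_iff hne]
    linarith
  ext i
  by_cases hi0 : i = 0
  · rw [h1] at h0
    rw [hi0]
    exact add_right_cancel h0
  by_cases hi1 : i = 1
  · rw [hi1, h1]
  · simpa [collapse, hi0, hi1] using congrFun h i


/-! ### The staged construction of tables -/

/-- A finite list of numbers, each with the code of a vector. -/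
abbrev Table (d : ℕ) : Type := List (ℕ × (Fin (d + 2) → ℕ))

/-- `collapse d N` is injective on the vectors of the table `L`. -/
def Separates (N : ℕ) (L : Table d) : Prop :=
  ∀ e ∈ L, ∀ e' ∈ L, vec (collapseCode N e.2) = vec (collapseCode N e'.2) → vec e.2 = vec e'.2

theorem primrecPred_separates :
    PrimrecPred fun q : ℕ × Table d => Separates q.1 q.2 := by
  refine primrecPred_forall_mem (l := fun q : ℕ × Table d => q.2) .snd
    (primrecPred_forall_mem (l := fun q : (ℕ × Table d) × (ℕ × (Fin (d + 2) → ℕ)) => q.1.2)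
      (.comp .snd .fst) (primrecPred_imp ?_ ?_))
  · exact primrecRel_vec_eq.comp
      (primrec_collapseCode.comp (.comp .fst (.comp .fst .fst)) (.comp .snd (.comp .snd .fst)))
      (primrec_collapseCode.comp (.comp .fst (.comp .fst .fst)) (.comp .snd .snd))
  · exact primrecRel_vec_eq.comp (.comp .snd (.comp .snd .fst)) (.comp .snd .snd)

theorem eventually_separates (L : Table d) : ∀ᶠ N in Filter.atTop, Separates N L := by
  have h : ∀ᶠ N in Filter.atTop, ∀ e ∈ {e | e ∈ L}, ∀ e' ∈ {e | e ∈ L},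
      collapse d N (vec e.2) = collapse d N (vec e'.2) → vec e.2 = vec e'.2 :=
    (Filter.eventually_all_finite L.finite_toSet).2 fun e _ =>
      (Filter.eventually_all_finite L.finite_toSet).2 fun e' _ => eventually_collapse_injective _ _
  filter_upwards [h] with N hN e he e' he' heq
  rw [vec_collapseCode, vec_collapseCode] at heq
  exact hN e he e' he' heq

/-- The code of the vector that may be added to the table at stage `t`. -/
def candidate (d t : ℕ) : Fin (d + 2) → ℕ := fun i =>
  (ofNat (List ℕ) t.unpair.1).getD i 0

open Classical in
/-- Add the candidate of stage `t` to the table, unless its vector is already there. -/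
noncomputable def extend (t g : ℕ) (L : Table d) : Table d :=
  if ∃ e ∈ L, vec e.2 = vec (candidate d t) then L else (Nat.pair t g, candidate d t) :: L

/-- The free parameter `t` makes every code a candidate at arbitrarily late stages, hence also after
the guess has settled. -/
theorem candidate_pair (c : Fin (d + 2) → ℕ) (t : ℕ) :
    candidate d (Nat.pair (encode (List.ofFn c)) t) = c := by
  ext i
  simp only [candidate, Nat.unpair_pair, ofNat_encode]
  simp [List.getD, -List.ofFn_succ]

theorem primrec_candidate : Primrec (candidate d) :=
  Primrec.fin_curry.2 ((Primrec.list_getD 0).comp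
    (.comp (.ofNat _) (primrec_unpair_fst .fst)) (.comp .fin_val .snd))

theorem primrec_extend :
    Primrec fun q : ℕ × ℕ × Table d => extend q.1 q.2.1 q.2.2 := by
  classical
  refine Primrec.ite (primrecPred_exists_mem (l := fun q : ℕ × ℕ × Table d => q.2.2)
    (.comp .snd .snd) ?_) (.comp .snd .snd) (Primrec.list_cons.comp (.pair ?_ ?_) (.comp .snd .snd))
  · exact primrecRel_vec_eq.comp (.comp .snd .snd) (primrec_candidate.comp (.comp .fst .fst))
  · exact Primrec₂.natPair.comp .fst (.comp .fst .snd)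
  · exact primrec_candidate.comp .fst

open Classical in
/-- One stage of a construction. A state consists of the values of a sequence seen so far, the
current guess at a number that is not a value of the sequence, and a datum. When the guess turns out
to be wrong and the condition `C` is satisfied, the guess and the datum are changed. -/
noncomputable def guessStep {τ : Type} (C : ℕ → τ → Prop) (change : ℕ → τ → τ)
    (keep : ℕ → ℕ → τ → τ) (t a : ℕ) (S : List ℕ × ℕ × τ) : List ℕ × ℕ × τ :=
  if S.2.1 ∈ a :: S.1 then
    if C t S.2.2 then (a :: S.1, S.2.1 + 1, change t S.2.2) else (a :: S.1, S.2.1, S.2.2)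
  else (a :: S.1, S.2.1, keep t S.2.1 S.2.2)

theorem guessStep_fst {τ : Type} (C : ℕ → τ → Prop) (change : ℕ → τ → τ)
    (keep : ℕ → ℕ → τ → τ) (t a : ℕ) (S : List ℕ × ℕ × τ) :
    (guessStep C change keep t a S).1 = a :: S.1 := by
  rw [guessStep]
  split_ifs <;> rfl

theorem primrec_guessStep {τ : Type} [Primcodable τ] {C : ℕ → τ → Prop} {change : ℕ → τ → τ}
    {keep : ℕ → ℕ → τ → τ} (hC : PrimrecRel C) (hchange : Primrec₂ change)
    (hkeep : Primrec fun q : ℕ × ℕ × τ => keep q.1 q.2.1 q.2.2) :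
    Primrec fun q : ℕ × ℕ × List ℕ × ℕ × τ => guessStep C change keep q.1 q.2.1 q.2.2 := by
  classical
  have ht : Primrec fun q : ℕ × ℕ × List ℕ × ℕ × τ => q.1 := .fst
  have hA : Primrec fun q : ℕ × ℕ × List ℕ × ℕ × τ => q.2.1 :: q.2.2.1 :=
    Primrec.list_cons.comp (.comp .fst .snd) (.comp .fst (.comp .snd .snd))
  have hS : Primrec fun q : ℕ × ℕ × List ℕ × ℕ × τ => q.2.2.2 := .comp .snd (.comp .snd .snd)
  have hg : Primrec fun q : ℕ × ℕ × List ℕ × ℕ × τ => q.2.2.2.1 := .comp .fst hS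
  have hL : Primrec fun q : ℕ × ℕ × List ℕ × ℕ × τ => q.2.2.2.2 := .comp .snd hS
  exact Primrec.ite (primrecPred_mem hg hA) (Primrec.ite (hC.comp ht hL)
    (.pair hA (.pair (Primrec.succ.comp hg) (hchange.comp ht hL))) (.pair hA (.pair hg hL)))
    (.pair hA (.pair hg (hkeep.comp (.pair ht (.pair hg hL)))))

/-- One stage of the construction of a vector space from a sequence: when the guess turns out to be
wrong, all vectors are moved to the hyperplane `v 1 = 0`. -/
noncomputable def tableStep : ℕ → ℕ → List ℕ × ℕ × Table d → List ℕ × ℕ × Table d :=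
  guessStep Separates (fun t L => L.map fun e => (e.1, collapseCode t e.2)) extend

theorem primrec_collapse_table :
    Primrec₂ fun (t : ℕ) (L : Table d) => L.map fun e => (e.1, collapseCode t e.2) :=
  Primrec.list_map (f := fun q : ℕ × Table d => q.2) .snd (Primrec.pair (.comp .fst .snd)
    (primrec_collapseCode.comp (.comp .fst .fst) (.comp .snd .snd))).to₂

theorem primrec_tableStep :
    Primrec fun q : ℕ × ℕ × List ℕ × ℕ × Table d => tableStep q.1 q.2.1 q.2.2 :=
  primrec_guessStep primrecPred_separates.primrecRel primrec_collapse_table primrec_extend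

/-! ### Invariants of the construction -/

/-- The state before stage `t`. -/
noncomputable def state (d : ℕ) (f : ℕ → ℕ) (t : ℕ) : List ℕ × ℕ × Table d :=
  run ([], 0, []) tableStep f t

/-- The guess before stage `t`. -/
noncomputable def guess (d : ℕ) (f : ℕ → ℕ) (t : ℕ) : ℕ := (state d f t).2.1

/-- The table before stage `t`. -/
noncomputable def table (d : ℕ) (f : ℕ → ℕ) (t : ℕ) : Table d := (state d f t).2.2

theorem mem_state_fst {f : ℕ → ℕ} {t a : ℕ} : a ∈ (state d f t).1 ↔ ∃ i < t, f i = a := by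
  have h : (state d f t).1 = ((List.range t).map f).reverse := by
    induction t with
    | zero => rfl
    | succ t ih =>
      have : (state d f (t + 1)).1 = f t :: (state d f t).1 := by
        rw [show state d f (t + 1) = tableStep t (f t) (state d f t) from rfl, tableStep,
          guessStep_fst]
      rw [this, ih, List.range_succ]
      simp
  simp [h]

/-- Advance, wait or grow. During a wait the table is frozen while the collapse parameter `t`
increases, so the wait must end. -/
theorem stage_cases (d : ℕ) (f : ℕ → ℕ) (t : ℕ) :
    ((∃ i ≤ t, f i = guess d f t) ∧ Separates t (table d f t) ∧
      guess d f (t + 1) = guess d f t + 1 ∧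
      table d f (t + 1) = (table d f t).map fun e => (e.1, collapseCode t e.2)) ∨
    ((∃ i ≤ t, f i = guess d f t) ∧ ¬ Separates t (table d f t) ∧
      guess d f (t + 1) = guess d f t ∧ table d f (t + 1) = table d f t) ∨
    ((¬ ∃ i ≤ t, f i = guess d f t) ∧ guess d f (t + 1) = guess d f t ∧
      table d f (t + 1) = extend t (guess d f t) (table d f t)) := by
  have hmem : (state d f t).2.1 ∈ f t :: (state d f t).1 ↔ ∃ i ≤ t, f i = guess d f t := by
    rw [List.mem_cons, mem_state_fst]
    simp only [Nat.le_iff_lt_or_eq, guess]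
    constructor
    · rintro (h | ⟨i, hi, h⟩)
      · exact ⟨t, .inr rfl, h.symm⟩
      · exact ⟨i, .inl hi, h⟩
    · rintro ⟨i, hi | rfl, h⟩
      · exact .inr ⟨i, hi, h⟩
      · exact .inl h.symm
  have hs : state d f (t + 1) = tableStep t (f t) (state d f t) := rfl
  rw [← hmem]
  by_cases h1 : (state d f t).2.1 ∈ f t :: (state d f t).1
  · by_cases h2 : Separates t (state d f t).2.2
    · refine .inl ⟨h1, h2, ?_, ?_⟩
      · rw [guess, hs, tableStep, guessStep, if_pos h1, if_pos h2, guess]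
      · rw [table, hs, tableStep, guessStep, if_pos h1, if_pos h2, table]
    · refine .inr (.inl ⟨h1, h2, ?_, ?_⟩)
      · rw [guess, hs, tableStep, guessStep, if_pos h1, if_neg h2, guess]
      · rw [table, hs, tableStep, guessStep, if_pos h1, if_neg h2, table]
  · refine .inr (.inr ⟨h1, ?_, ?_⟩)
    · rw [guess, hs, tableStep, guessStep, if_neg h1, guess]
    · rw [table, hs, tableStep, guessStep, if_neg h1, table, guess]

theorem mem_extend {t g : ℕ} {L : Table d} {e : ℕ × (Fin (d + 2) → ℕ)} (h : e ∈ extend t g L) :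
    e ∈ L ∨ e.1 = Nat.pair t g ∧ ∀ e' ∈ L, vec e'.2 ≠ vec e.2 := by
  rw [extend] at h
  split_ifs at h with hc
  · exact .inl h
  · rcases List.mem_cons.1 h with rfl | h
    · push Not at hc
      exact .inr ⟨rfl, hc⟩
    · exact .inl h

theorem subset_extend {t g : ℕ} {L : Table d} : L ⊆ extend t g L := by
  rw [extend]
  split_ifs
  · exact fun _ h => h
  · exact List.subset_cons_self _ _

theorem exists_mem_extend (t g : ℕ) (L : Table d) :
    ∃ e ∈ extend t g L, vec e.2 = vec (candidate d t) := by
  rw [extend]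
  split_ifs with h
  · exact h
  · exact ⟨_, List.mem_cons_self, rfl⟩

theorem guess_mono (d : ℕ) (f : ℕ → ℕ) : Monotone (guess d f) := by
  refine monotone_nat_of_le_succ fun t => ?_
  rcases stage_cases d f t with ⟨-, -, h, -⟩ | ⟨-, -, h, -⟩ | ⟨-, h, -⟩ <;> omega

/-- The guess leaves a value only after that value has occurred in `f`, so it cannot get past `m`.
-/
theorem guess_le {f : ℕ → ℕ} {m : ℕ} (hm : m ∉ Set.range f) (t : ℕ) : guess d f t ≤ m := by
  induction t with
  | zero => exact Nat.zero_le _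
  | succ t ih =>
    rcases stage_cases d f t with ⟨⟨i, -, hi⟩, -, h, -⟩ | ⟨-, -, h, -⟩ | ⟨-, h, -⟩
    · rcases ih.lt_or_eq with hlt | heq
      · omega
      · exact absurd ⟨i, hi.trans heq⟩ hm
    · omega
    · omega

/-- The guess is eventually constant and correct. -/
theorem exists_limit_guess {f : ℕ → ℕ} (hf : ∃ m, m ∉ Set.range f) :
    ∃ T m, m ∉ Set.range f ∧ ∀ t, T ≤ t → guess d f t = m := by
  obtain ⟨b, hb⟩ := hf
  obtain ⟨T, hT⟩ : ∃ T, ∀ t, T ≤ t → guess d f t = guess d f T := by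
    by_contra! hcon
    have hlt : ∀ j, ∃ t, j ≤ guess d f t := by
      intro j
      induction j with
      | zero => exact ⟨0, Nat.zero_le _⟩
      | succ j ih =>
        obtain ⟨t, ht⟩ := ih
        obtain ⟨t', htt', hne⟩ := hcon t
        have := guess_mono d f htt'
        exact ⟨t', by omega⟩
    obtain ⟨t, ht⟩ := hlt (b + 1)
    have := guess_le (d := d) hb t
    omega
  refine ⟨T, guess d f T, ?_, hT⟩
  rintro ⟨i, hi⟩
  have hconst : ∀ t, max T i ≤ t → ¬ Separates t (table d f t) ∧
      table d f (t + 1) = table d f t := by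
    intro t ht
    have h1 := hT t (by omega)
    have h2 := hT (t + 1) (by omega)
    rcases stage_cases d f t with ⟨-, -, h, -⟩ | ⟨-, hs, -, h⟩ | ⟨h, -⟩
    · omega
    · exact ⟨hs, h⟩
    · exact absurd ⟨i, by omega, hi.trans h1.symm⟩ h
  have htab : ∀ t, max T i ≤ t → table d f t = table d f (max T i) := by
    intro t ht
    induction t, ht using Nat.le_induction with
    | base => rfl
    | succ t ht ih => exact (hconst t ht).2.trans ih
  obtain ⟨t, ht, hs⟩ := ((Filter.eventually_ge_atTop (max T i)).and
    (eventually_separates (table d f (max T i)))).exists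
  exact (hconst t ht).1 (htab t ht ▸ hs)

/-- A number records the stage and the guess of its introduction. An outdated guess means that a
collapse has happened since, and growing the table does not move old vectors. -/
theorem table_numbers {f : ℕ → ℕ} {t : ℕ} {e : ℕ × (Fin (d + 2) → ℕ)} (he : e ∈ table d f t) :
    e.1.unpair.1 < t ∧ e.1.unpair.2 ≤ guess d f t ∧
      (e.1.unpair.2 ≠ guess d f t → vec e.2 1 = 0) := by
  induction t generalizing e with
  | zero => exact absurd he (List.not_mem_nil)
  | succ t ih =>
    rcases stage_cases d f t with ⟨-, -, hg, h⟩ | ⟨-, -, hg, h⟩ | ⟨-, hg, h⟩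
    · rw [h, List.mem_map] at he
      obtain ⟨e, he, rfl⟩ := he
      obtain ⟨h1, h2, -⟩ := ih he
      refine ⟨by simp only; omega, by simp only; omega, fun _ => ?_⟩
      rw [vec_collapseCode, collapse_apply_one]
    · rw [h] at he
      obtain ⟨h1, h2, h3⟩ := ih he
      rw [hg]
      exact ⟨by omega, h2, h3⟩
    · rw [h] at he
      rw [hg]
      rcases mem_extend he with he | ⟨he, -⟩
      · obtain ⟨h1, h2, h3⟩ := ih he
        exact ⟨by omega, h2, h3⟩
      · simp [he]

theorem table_injective {f : ℕ → ℕ} {t : ℕ} {e e' : ℕ × (Fin (d + 2) → ℕ)}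
    (he : e ∈ table d f t) (he' : e' ∈ table d f t) : e.1 = e'.1 ↔ vec e.2 = vec e'.2 := by
  induction t generalizing e e' with
  | zero => exact absurd he (List.not_mem_nil)
  | succ t ih =>
    rcases stage_cases d f t with ⟨-, hs, -, h⟩ | ⟨-, -, -, h⟩ | ⟨-, -, h⟩
    · rw [h, List.mem_map] at he he'
      obtain ⟨e, he, rfl⟩ := he
      obtain ⟨e', he', rfl⟩ := he'
      refine (ih he he').trans ⟨fun heq => ?_, hs e he e' he'⟩
      simp only [vec_collapseCode, heq]
    · rw [h] at he he'
      exact ih he he'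
    · rw [h] at he he'
      -- Old numbers have a stage component below `t`, so the new number is fresh.
      have hnew : ∀ {a}, a ∈ table d f t → a.1 ≠ Nat.pair t (guess d f t) := by
        intro a ha heq
        have := (table_numbers ha).1
        simp [heq] at this
      rw [extend] at he he'
      split_ifs at he he' with hc
      · exact ih he he'
      · rw [List.mem_cons] at he he'
        push Not at hc
        rcases he with rfl | he <;> rcases he' with rfl | he'
        · simp
        · exact iff_of_false (hnew he').symm (hc _ he').symm
        · exact iff_of_false (hnew he) (hc _ he)
        · exact ih he he'

/-- The vectors of a table are moved by a linear map. -/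
theorem exists_linearMap_table (d : ℕ) (f : ℕ → ℕ) {s t : ℕ} (hst : s ≤ t) :
    ∃ φ : (Fin (d + 2) → ℚ) →ₗ[ℚ] (Fin (d + 2) → ℚ), ∀ e ∈ table d f s,
      ∃ e' ∈ table d f t, e'.1 = e.1 ∧ vec e'.2 = φ (vec e.2) := by
  induction t, hst using Nat.le_induction with
  | base => exact ⟨LinearMap.id, fun e he => ⟨e, he, rfl, rfl⟩⟩
  | succ t hst ih =>
    obtain ⟨φ, hφ⟩ := ih
    rcases stage_cases d f t with ⟨-, -, -, h⟩ | ⟨-, -, -, h⟩ | ⟨-, -, h⟩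
    · refine ⟨(collapse d t).comp φ, fun e he => ?_⟩
      obtain ⟨e', he', h1, h2⟩ := hφ e he
      refine ⟨(e'.1, collapseCode t e'.2), h ▸ List.mem_map_of_mem he', h1, ?_⟩
      rw [vec_collapseCode, h2, LinearMap.comp_apply]
    · exact ⟨φ, h ▸ hφ⟩
    · refine ⟨φ, fun e he => ?_⟩
      obtain ⟨e', he', hh⟩ := hφ e he
      exact ⟨e', h ▸ subset_extend he', hh⟩

/-- Collapsing keeps numbers, and a number introduced at stage `t` has stage component `t`. Hence
membership of a number in the limit space is decided at a bounded stage. -/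
theorem table_numbers_of_lt {f : ℕ → ℕ} {s t : ℕ} (hst : s ≤ t) {e : ℕ × (Fin (d + 2) → ℕ)}
    (he : e ∈ table d f t) (hs : e.1.unpair.1 < s) : ∃ e' ∈ table d f s, e'.1 = e.1 := by
  induction t, hst using Nat.le_induction generalizing e with
  | base => exact ⟨e, he, rfl⟩
  | succ t hst ih =>
    rcases stage_cases d f t with ⟨-, -, -, h⟩ | ⟨-, -, -, h⟩ | ⟨-, -, h⟩
    · rw [h, List.mem_map] at he
      obtain ⟨a, ha, rfl⟩ := he
      obtain ⟨e', he', h⟩ := ih ha hs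
      exact ⟨e', he', h⟩
    · exact ih (h ▸ he) hs
    · rcases mem_extend (h ▸ he) with he | ⟨he, -⟩
      · exact ih he hs
      · rw [he, Nat.unpair_pair] at hs
        simp only at hs
        omega

/-! ### The limit numbering -/

/-- `eV` assigns to every vector the number that it has in the limit of the tables. -/
structure IsLimitNumbering (f : ℕ → ℕ) (eV : (Fin (d + 2) → ℚ) → ℕ) : Prop where
  injective : Function.Injective eV
  exists_linearMap : ∀ s, ∃ φ : (Fin (d + 2) → ℚ) →ₗ[ℚ] (Fin (d + 2) → ℚ),
    ∀ e ∈ table d f s, eV (φ (vec e.2)) = e.1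
  exists_mem_of_lt : ∀ v s, eV v < s → ∃ e ∈ table d f s, e.1 = eV v
  eventually_mem : ∀ v, ∀ᶠ s in Filter.atTop, ∃ e ∈ table d f s, e.1 = eV v ∧ vec e.2 = v

/-- Vectors outside of the hyperplane `v 1 = 0` have numbers that contain the final guess. -/
theorem exists_isLimitNumbering (d : ℕ) {f : ℕ → ℕ} (hf : ∃ m, m ∉ Set.range f) :
    ∃ eV : (Fin (d + 2) → ℚ) → ℕ, IsLimitNumbering f eV ∧
      ∃ m, m ∉ Set.range f ∧ ∀ v, (eV v).unpair.2 ≤ m ∧ ((eV v).unpair.2 ≠ m → v 1 = 0) := by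
  obtain ⟨T, m, hm, hT⟩ := exists_limit_guess (d := d) hf
  -- Once the guess is final, vectors no longer move and the table only grows.
  have hext : ∀ t, T ≤ t → table d f (t + 1) = extend t (guess d f t) (table d f t) := by
    intro t ht
    have h1 := hT t ht
    have h2 := hT (t + 1) (by omega)
    rcases stage_cases d f t with ⟨⟨i, -, hi⟩, -⟩ | ⟨⟨i, -, hi⟩, -⟩ | ⟨-, -, h⟩
    · exact absurd ⟨i, hi.trans h1⟩ hm
    · exact absurd ⟨i, hi.trans h1⟩ hm
    · exact h
  have hmono : ∀ s, T ≤ s → ∀ t, s ≤ t → table d f s ⊆ table d f t := by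
    intro s hs t hst
    induction t, hst using Nat.le_induction with
    | base => exact fun _ h => h
    | succ t hst ih =>
      rw [hext t (hs.trans hst)]
      exact fun _ h => subset_extend (ih h)
  have hex : ∀ v, ∃ x, ∃ t, T ≤ t ∧ ∃ e ∈ table d f t, e.1 = x ∧ vec e.2 = v := by
    intro v
    obtain ⟨c, rfl⟩ := vec_surjective v
    have hle : T ≤ Nat.pair (encode (List.ofFn c)) T := Nat.right_le_pair _ _
    obtain ⟨e, he, hv⟩ := exists_mem_extend (Nat.pair (encode (List.ofFn c)) T)
      (guess d f (Nat.pair (encode (List.ofFn c)) T)) (table d f (Nat.pair (encode (List.ofFn c)) T))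
    rw [← hext _ hle] at he
    refine ⟨e.1, _, hle.trans (Nat.le_succ _), e, he, rfl, ?_⟩
    rw [hv, candidate_pair]
  choose eV tV htV e heT he1 he2 using hex
  have hmem : ∀ v t, max T (tV v) ≤ t → e v ∈ table d f t := fun v t ht =>
    hmono _ (htV v) t (le_trans (le_max_right _ _) ht) (heT v)
  have heq : ∀ t, T ≤ t → ∀ a ∈ table d f t, eV (vec a.2) = a.1 := by
    intro t ht a ha
    have h1 := hmem (vec a.2) (max t (tV (vec a.2))) (by omega)
    have h2 := hmono t ht (max t (tV (vec a.2))) (le_max_left _ _) ha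
    rw [← he1 (vec a.2), table_injective h1 h2, he2]
  refine ⟨eV, ⟨?_, ?_, ?_, ?_⟩, m, hm, ?_⟩
  · intro v w hvw
    have h1 := hmem v (max T (max (tV v) (tV w))) (by omega)
    have h2 := hmem w (max T (max (tV v) (tV w))) (by omega)
    rw [← he1 v, ← he1 w, table_injective h1 h2, he2, he2] at hvw
    exact hvw
  · intro s
    -- The map that carries stage `s` past `T` already carries it to the limit.
    obtain ⟨φ, hφ⟩ := exists_linearMap_table d f (le_max_left s T)
    refine ⟨φ, fun a ha => ?_⟩
    obtain ⟨b, hb, h1, h2⟩ := hφ a ha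
    rw [← h2, heq _ (le_max_right s T) b hb, h1]
  · intro v s hs
    obtain ⟨a, ha, h⟩ := table_numbers_of_lt (le_max_left s (max T (tV v)))
      (hmem v _ (le_max_right _ _)) ((Nat.unpair_left_le _).trans_lt ((he1 v).symm ▸ hs))
    exact ⟨a, ha, h.trans (he1 v)⟩
  · intro v
    filter_upwards [Filter.eventually_ge_atTop (max T (tV v))] with s hs
    exact ⟨e v, hmem v s hs, he1 v, he2 v⟩
  · intro v
    obtain ⟨-, h2, h3⟩ := table_numbers (heT v)
    rw [hT _ (htV v), he1] at h2 h3
    rw [he2] at h3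
    exact ⟨h2, h3⟩


/-! ### Computing the code of the limit space -/

/-- Coordinatewise addition on codes. -/
def addVecCode {n : ℕ} (c c' : Fin n → ℕ) : Fin n → ℕ := fun i => addCode (c i) (c' i)

/-- Scalar multiplication on codes. -/
def smulVecCode {n : ℕ} (x : ℕ) (c : Fin n → ℕ) : Fin n → ℕ := fun i => mulCode x (c i)

theorem vec_addVecCode {n : ℕ} (c c' : Fin n → ℕ) : vec (addVecCode c c') = vec c + vec c' :=
  funext fun _ => rat_addCode _ _

theorem vec_smulVecCode {n : ℕ} (x : ℕ) (c : Fin n → ℕ) :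
    vec (smulVecCode x c) = rat x • vec c :=
  funext fun _ => rat_mulCode _ _

theorem vec_zero {n : ℕ} : vec (0 : Fin n → ℕ) = 0 :=
  funext fun _ => rat_zero

theorem primrec_addVecCode {n : ℕ} :
    Primrec₂ (addVecCode : (Fin n → ℕ) → (Fin n → ℕ) → Fin n → ℕ) :=
  Primrec.fin_curry.2 (primrec_addCode.comp (Primrec.fin_app.comp (.comp .fst .fst) .snd)
    (Primrec.fin_app.comp (.comp .snd .fst) .snd))

theorem primrec_smulVecCode {n : ℕ} :
    Primrec₂ (smulVecCode : ℕ → (Fin n → ℕ) → Fin n → ℕ) :=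
  Primrec.fin_curry.2 (primrec_mulCode.comp (.comp .fst .fst)
    (Primrec.fin_app.comp (.comp .snd .fst) .snd))

/-- `x` is the number of a vector in the table `L`. -/
def Has (L : Table d) (x : ℕ) : Prop := ∃ a ∈ L, a.1 = x

/-- According to the table `L`, the vector number `z` is the sum of those numbered `x` and `y`. -/
def SumIn (L : Table d) (x y z : ℕ) : Prop :=
  ∃ a ∈ L, a.1 = x ∧ ∃ b ∈ L, b.1 = y ∧ ∃ c ∈ L, c.1 = z ∧ vec c.2 = vec (addVecCode a.2 b.2)

/-- According to the table `L`, the vector number `z` is `rat x` times the one numbered `y`. -/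
def SmulIn (L : Table d) (x y z : ℕ) : Prop :=
  ∃ b ∈ L, b.1 = y ∧ ∃ c ∈ L, c.1 = z ∧ vec c.2 = vec (smulVecCode x b.2)

/-- According to the table `L`, the vector number `z` is zero. -/
def ZeroIn (L : Table d) (z : ℕ) : Prop :=
  ∃ c ∈ L, c.1 = z ∧ vec c.2 = vec (0 : Fin (d + 2) → ℕ)

/-- At stage `s` with the table `L`, the value `z` is put out for the argument `j` of component `i`
of the code of the vector space. -/
def Output (i j s : ℕ) (L : Table d) (z : ℕ) : Prop :=
  i = 0 ∧ (z = 1 ∧ IsLeastCode j ∨ z = 0 ∧ ¬ IsLeastCode j) ∨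
  i = 1 ∧ IsLeastCode z ∧ rat z = rat (addCode j.unpair.1 j.unpair.2) ∨
  i = 2 ∧ IsLeastCode z ∧ rat z = rat (mulCode j.unpair.1 j.unpair.2) ∨
  i = 3 ∧ IsLeastCode z ∧ rat z = rat (Nat.pair j 0) ∨
  i = 4 ∧ j < s ∧ (z = 1 ∧ Has L j ∨ z = 0 ∧ ¬ Has L j) ∨
  i = 5 ∧ (SumIn L j.unpair.1 j.unpair.2 z ∨
    z = 0 ∧ j < s ∧ ¬ (Has L j.unpair.1 ∧ Has L j.unpair.2)) ∨
  i = 6 ∧ (SmulIn L j.unpair.1 j.unpair.2 z ∨ z = 0 ∧ j < s ∧ ¬ Has L j.unpair.2) ∨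
  i = 7 ∧ ZeroIn L z ∨
  7 < i ∧ z = 0

section Primrec

variable {α : Type} [Primcodable α] {L : α → Table d} {x y z : α → ℕ}

theorem primrecPred_eq (hx : Primrec x) (hy : Primrec y) : PrimrecPred fun a => x a = y a :=
  Primrec.eq.comp hx hy

theorem primrecPred_has (hL : Primrec L) (hx : Primrec x) :
    PrimrecPred fun a => Has (L a) (x a) :=
  primrecPred_exists_mem hL (primrecPred_eq (.comp .fst .snd) (.comp hx .fst))

theorem primrecPred_exists_number {R : α → (Fin (d + 2) → ℕ) → Prop} (hL : Primrec L)
    (hx : Primrec x) (hR : PrimrecRel R) :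
    PrimrecPred fun a => ∃ b ∈ L a, b.1 = x a ∧ R a b.2 :=
  primrecPred_exists_mem hL (.and (primrecPred_eq (.comp .fst .snd) (.comp hx .fst))
    (hR.comp .fst (.comp .snd .snd)))

theorem primrecPred_zeroIn (hL : Primrec L) (hz : Primrec z) :
    PrimrecPred fun a => ZeroIn (L a) (z a) :=
  primrecPred_exists_number (R := fun _ c => vec c = vec (0 : Fin (d + 2) → ℕ)) hL hz
    (primrecRel_vec_eq.comp .snd (.const _))

theorem primrecPred_smulIn (hL : Primrec L) (hx : Primrec x) (hy : Primrec y) (hz : Primrec z) :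
    PrimrecPred fun a => SmulIn (L a) (x a) (y a) (z a) :=
  primrecPred_exists_number
    (R := fun a b => ∃ c ∈ L a, c.1 = z a ∧ vec c.2 = vec (smulVecCode (x a) b)) hL hy
    (primrecPred_exists_number (R := fun (q : α × (Fin (d + 2) → ℕ)) c =>
      vec c = vec (smulVecCode (x q.1) q.2)) (.comp hL .fst) (.comp hz .fst)
      (primrecRel_vec_eq.comp .snd
        (primrec_smulVecCode.comp (.comp hx (.comp .fst .fst)) (.comp .snd .fst))))

theorem primrecPred_sumIn (hL : Primrec L) (hx : Primrec x) (hy : Primrec y) (hz : Primrec z) :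
    PrimrecPred fun a => SumIn (L a) (x a) (y a) (z a) :=
  primrecPred_exists_number
    (R := fun a u => ∃ b ∈ L a, b.1 = y a ∧ ∃ c ∈ L a, c.1 = z a ∧
      vec c.2 = vec (addVecCode u b.2)) hL hx
    (primrecPred_exists_number (R := fun (q : α × (Fin (d + 2) → ℕ)) v =>
      ∃ c ∈ L q.1, c.1 = z q.1 ∧ vec c.2 = vec (addVecCode q.2 v)) (.comp hL .fst) (.comp hy .fst)
      (primrecPred_exists_number (R := fun (q : (α × (Fin (d + 2) → ℕ)) × (Fin (d + 2) → ℕ)) c =>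
        vec c = vec (addVecCode q.1.2 q.2)) (.comp hL (.comp .fst .fst))
        (.comp hz (.comp .fst .fst))
        (primrecRel_vec_eq.comp .snd
          (primrec_addVecCode.comp (.comp .snd (.comp .fst .fst)) (.comp .snd .fst)))))

theorem primrecPred_output {i j s : α → ℕ} (hi : Primrec i) (hj : Primrec j) (hs : Primrec s)
    (hL : Primrec L) (hz : Primrec z) :
    PrimrecPred fun a => Output (i a) (j a) (s a) (L a) (z a) := by
  have hj1 := primrec_unpair_fst hj
  have hj2 := primrec_unpair_snd hj
  have is (m : ℕ) : PrimrecPred fun a => i a = m := primrecPred_eq hi (.const m)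
  have zs (m : ℕ) : PrimrecPred fun a => z a = m := primrecPred_eq hz (.const m)
  have hlt : PrimrecPred fun a => j a < s a := Primrec.nat_lt.comp hj hs
  have hleast : PrimrecPred fun a => IsLeastCode (z a) := primrecPred_isLeastCode.comp hz
  have hleast' : PrimrecPred fun a => IsLeastCode (j a) := primrecPred_isLeastCode.comp hj
  have hhas := primrecPred_has hL hj
  have hhas1 := primrecPred_has hL hj1
  have hhas2 := primrecPred_has hL hj2
  refine .or (.and (is 0) (.or (.and (zs 1) hleast') (.and (zs 0) hleast'.not))) ?_
  refine .or (.and (is 1) (.and hleast (primrecRel_rat_eq.comp hz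
    (primrec_addCode.comp hj1 hj2)))) ?_
  refine .or (.and (is 2) (.and hleast (primrecRel_rat_eq.comp hz
    (primrec_mulCode.comp hj1 hj2)))) ?_
  refine .or (.and (is 3) (.and hleast (primrecRel_rat_eq.comp hz
    (Primrec₂.natPair.comp hj (.const 0))))) ?_
  refine .or (.and (is 4) (.and hlt (.or (.and (zs 1) hhas) (.and (zs 0) hhas.not)))) ?_
  refine .or (.and (is 5) (.or (primrecPred_sumIn hL hj1 hj2 hz)
    (.and (zs 0) (.and hlt (.not (.and hhas1 hhas2)))))) ?_
  refine .or (.and (is 6) (.or (primrecPred_smulIn hL hj1 hj2 hz)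
    (.and (zs 0) (.and hlt hhas2.not)))) ?_
  exact .or (.and (is 7) (primrecPred_zeroIn hL hz))
    (.and (Primrec.nat_lt.comp (.const 7) hi) (zs 0))

end Primrec

open Classical in
/-- Component `i` of the code of the vector space `ℚ ^ (d + 2)` whose vectors are numbered
by `eV`. -/
noncomputable def codeValue (eV : (Fin (d + 2) → ℚ) → ℕ) (i j : ℕ) : ℕ :=
  match i with
  | 0 => charFun (Set.range ratCode) j
  | 1 => ratCode (rat j.unpair.1 + rat j.unpair.2)
  | 2 => ratCode (rat j.unpair.1 * rat j.unpair.2)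
  | 3 => ratCode j
  | 4 => charFun (Set.range eV) j
  | 5 => if j.unpair.1 ∈ Set.range eV ∧ j.unpair.2 ∈ Set.range eV then
      eV (Function.invFun eV j.unpair.1 + Function.invFun eV j.unpair.2) else 0
  | 6 => if j.unpair.2 ∈ Set.range eV then
      eV (rat j.unpair.1 • Function.invFun eV j.unpair.2) else 0
  | 7 => eV 0
  | _ => 0

theorem codes_codeValue {eV : (Fin (d + 2) → ℚ) → ℕ} (h : Function.Injective eV) :
    Codes (fun k => codeValue eV k.unpair.1 k.unpair.2) ratCode eV := by
  have hinv := Function.leftInverse_invFun h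
  refine ⟨ratCode_injective, h, ?_, ?_, ?_, ?_, ?_, ?_, ?_, ?_, ?_⟩
  · ext j
    simp [col, codeValue]
  · intro a b
    simp [col, codeValue, rat_ratCode]
  · intro a b
    simp [col, codeValue, rat_ratCode]
  · simp [col, codeValue]
  · simp [col, codeValue]
  · ext j
    simp [col, codeValue]
  · intro v w
    simp [col, codeValue, hinv v, hinv w]
  · intro a v
    simp [col, codeValue, hinv v, rat_ratCode]
  · simp [col, codeValue]

section Limit

variable {f : ℕ → ℕ} {eV : (Fin (d + 2) → ℚ) → ℕ}

theorem IsLimitNumbering.mem_range (h : IsLimitNumbering f eV) {s x : ℕ}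
    (hx : Has (table d f s) x) : x ∈ Set.range eV := by
  obtain ⟨a, ha, rfl⟩ := hx
  obtain ⟨φ, hφ⟩ := h.exists_linearMap s
  exact ⟨_, hφ a ha⟩

theorem IsLimitNumbering.has_iff (h : IsLimitNumbering f eV) {s x : ℕ} (hs : x < s) :
    Has (table d f s) x ↔ x ∈ Set.range eV := by
  refine ⟨h.mem_range, ?_⟩
  rintro ⟨v, rfl⟩
  exact h.exists_mem_of_lt v s hs

/-- Even tables from before the last collapse give correct values: a linear map takes them to the
limit while preserving numbers, so the relations they show persist. Negative answers are given only
for arguments below `s`, where membership is settled. -/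
theorem IsLimitNumbering.output_unique (h : IsLimitNumbering f eV) {i j s z : ℕ}
    (hz : Output i j s (table d f s) z) : z = codeValue eV i j := by
  classical
  have hinv := Function.leftInverse_invFun h.injective
  rcases hz with ⟨rfl, hz⟩ | ⟨rfl, hl, hz⟩ | ⟨rfl, hl, hz⟩ | ⟨rfl, hl, hz⟩ | ⟨rfl, hj, hz⟩ |
    ⟨rfl, hz⟩ | ⟨rfl, hz⟩ | ⟨rfl, hz⟩ | ⟨hi, rfl⟩
  · rcases hz with ⟨rfl, hj⟩ | ⟨rfl, hj⟩ <;> rw [← mem_range_ratCode] at hj <;>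
      simp only [codeValue, charFun, Set.indicator, hj, if_true, if_false, Pi.one_apply]
  · rw [hl.eq_ratCode, hz, rat_addCode]
    rfl
  · rw [hl.eq_ratCode, hz, rat_mulCode]
    rfl
  · rw [hl.eq_ratCode, hz, rat_natCast]
    rfl
  · rcases hz with ⟨rfl, hz⟩ | ⟨rfl, hz⟩ <;> rw [h.has_iff hj] at hz <;>
      simp only [codeValue, charFun, Set.indicator, hz, if_true, if_false, Pi.one_apply]
  · rcases hz with ⟨a, ha, hax, b, hb, hby, c, hc, rfl, hv⟩ | ⟨rfl, hj, hz⟩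
    · obtain ⟨φ, hφ⟩ := h.exists_linearMap s
      have hx := hφ a ha
      have hy := hφ b hb
      rw [hax] at hx
      rw [hby] at hy
      rw [← hφ c hc, hv, vec_addVecCode, map_add]
      simp only [codeValue]
      rw [← hx, ← hy, if_pos ⟨⟨_, rfl⟩, ⟨_, rfl⟩⟩, hinv, hinv]
    · rw [h.has_iff ((Nat.unpair_left_le _).trans_lt hj),
        h.has_iff ((Nat.unpair_right_le _).trans_lt hj)] at hz
      simp only [codeValue]
      rw [if_neg hz]
  · rcases hz with ⟨b, hb, hby, c, hc, rfl, hv⟩ | ⟨rfl, hj, hz⟩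
    · obtain ⟨φ, hφ⟩ := h.exists_linearMap s
      have hy := hφ b hb
      rw [hby] at hy
      rw [← hφ c hc, hv, vec_smulVecCode, map_smul]
      simp only [codeValue]
      rw [← hy, if_pos ⟨_, rfl⟩, hinv]
    · rw [h.has_iff ((Nat.unpair_right_le _).trans_lt hj)] at hz
      simp only [codeValue]
      rw [if_neg hz]
  · obtain ⟨c, hc, rfl, hv⟩ := hz
    obtain ⟨φ, hφ⟩ := h.exists_linearMap s
    rw [← hφ c hc, hv, vec_zero, map_zero]
    rfl
  · obtain ⟨i, rfl⟩ := Nat.exists_eq_add_of_le' hi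
    rfl

theorem IsLimitNumbering.eventually_output (h : IsLimitNumbering f eV) (i j : ℕ) :
    ∀ᶠ s in Filter.atTop, Output i j s (table d f s) (codeValue eV i j) := by
  classical
  have hinv := Function.leftInverse_invFun h.injective
  rcases lt_or_ge 7 i with hi | hi
  · obtain ⟨i, rfl⟩ := Nat.exists_eq_add_of_le' hi
    refine .of_forall fun s => ?_
    simp only [Output]
    iterate 8 right
    exact ⟨hi, rfl⟩
  filter_upwards [Filter.eventually_gt_atTop j, h.eventually_mem 0,
    h.eventually_mem (Function.invFun eV j.unpair.1),
    h.eventually_mem (Function.invFun eV j.unpair.2),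
    h.eventually_mem (Function.invFun eV j.unpair.1 + Function.invFun eV j.unpair.2),
    h.eventually_mem (rat j.unpair.1 • Function.invFun eV j.unpair.2)] with
    s hs ⟨z, hz, hz1, hz2⟩ ⟨a, ha, ha1, ha2⟩ ⟨b, hb, hb1, hb2⟩ ⟨c, hc, hc1, hc2⟩ ⟨e, he, he1, he2⟩
  have hj1 := h.has_iff ((Nat.unpair_left_le j).trans_lt hs)
  have hj2 := h.has_iff ((Nat.unpair_right_le j).trans_lt hs)
  interval_cases i
  · refine .inl ⟨rfl, ?_⟩
    by_cases hj : IsLeastCode j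
    · simp [hj, codeValue, charFun, mem_range_ratCode.2 hj]
    · have hj' := mt mem_range_ratCode.1 hj
      simp only [codeValue, charFun, Set.indicator, hj', if_false]
      exact .inr ⟨trivial, hj⟩
  · refine .inr (.inl ⟨rfl, isLeastCode_ratCode _, ?_⟩)
    rw [rat_addCode]
    exact rat_ratCode _
  · refine .inr (.inr (.inl ⟨rfl, isLeastCode_ratCode _, ?_⟩))
    rw [rat_mulCode]
    exact rat_ratCode _
  · refine .inr (.inr (.inr (.inl ⟨rfl, isLeastCode_ratCode _, ?_⟩)))
    rw [rat_natCast]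
    exact rat_ratCode _
  · refine .inr (.inr (.inr (.inr (.inl ⟨rfl, hs, ?_⟩))))
    rw [h.has_iff hs]
    by_cases hj : j ∈ Set.range eV
    · exact .inl ⟨by simp only [codeValue, charFun, Set.indicator, hj, if_true, Pi.one_apply], hj⟩
    · exact .inr ⟨by simp only [codeValue, charFun, Set.indicator, hj, if_false], hj⟩
  · refine .inr (.inr (.inr (.inr (.inr (.inl ⟨rfl, ?_⟩)))))
    simp only [codeValue]
    by_cases hj : j.unpair.1 ∈ Set.range eV ∧ j.unpair.2 ∈ Set.range eV
    · rw [if_pos hj]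
      refine .inl ⟨a, ha, ha1.trans (Function.invFun_eq hj.1), b, hb,
        hb1.trans (Function.invFun_eq hj.2), c, hc, hc1, ?_⟩
      rw [vec_addVecCode, ha2, hb2, hc2]
    · rw [if_neg hj, hj1, hj2]
      exact .inr ⟨rfl, hs, hj⟩
  · refine .inr (.inr (.inr (.inr (.inr (.inr (.inl ⟨rfl, ?_⟩))))))
    simp only [codeValue]
    by_cases hj : j.unpair.2 ∈ Set.range eV
    · rw [if_pos hj]
      refine .inl ⟨b, hb, hb1.trans (Function.invFun_eq hj), e, he, he1, ?_⟩
      rw [vec_smulVecCode, hb2, he2]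
    · rw [if_neg hj, hj2]
      exact .inr ⟨rfl, hs, hj⟩
  · refine .inr (.inr (.inr (.inr (.inr (.inr (.inr (.inl ⟨rfl, z, hz, hz1, ?_⟩)))))))
    rw [hz2, vec_zero]

end Limit

/-- A functional that computes a code of a vector space over `ℚ`. -/
theorem exists_functional_space (d : ℕ) :
    ∃ F, RecursiveFunctional F ∧ ∀ (f : ℕ → ℕ) (eV : (Fin (d + 2) → ℚ) → ℕ),
      IsLimitNumbering f eV → ∀ k, codeValue eV k.unpair.1 k.unpair.2 ∈ F f k := by
  have hL : Primrec fun q : ℕ × ℕ × List ℕ × ℕ × Table d => q.2.2.2.2 :=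
    .comp .snd (.comp .snd (.comp .snd .snd))
  obtain ⟨F, hF, hF'⟩ := exists_search ([], 0, []) (primrec_tableStep (d := d))
    -- The search variable is both the stage and, through its first component, the proposed value.
    (R := fun k s S => Output k.unpair.1 k.unpair.2 s S.2.2 s.unpair.1)
    (primrecPred_output (primrec_unpair_fst .fst) (primrec_unpair_snd .fst) (.comp .fst .snd) hL
      (primrec_unpair_fst (.comp .fst .snd)))
    (out := fun _ s _ => s.unpair.1) (primrec_unpair_fst (.comp .fst .snd))
  refine ⟨F, hF, fun f eV h k => hF' f k _ ?_ fun s hs => h.output_unique hs⟩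
  obtain ⟨s, hs⟩ := Filter.eventually_atTop.1 (h.eventually_output k.unpair.1 k.unpair.2)
  refine ⟨Nat.pair (codeValue eV k.unpair.1 k.unpair.2) s, ?_⟩
  have := hs _ (Nat.right_le_pair (codeValue eV k.unpair.1 k.unpair.2) s)
  rw [Nat.unpair_pair (codeValue eV k.unpair.1 k.unpair.2) s]
  exact this

/-! ### Closed choice reduces to finding a basis -/

/-- A functional that computes the largest second component of an element of a set of `n`
numbers. -/
theorem exists_functional_sup (n : ℕ) :
    ∃ G, RecursiveFunctional G ∧ ∀ S : Finset ℕ, S.card = n → ∀ k,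
      S.sup (fun x => x.unpair.2) ∈ G (charFun S) k := by
  -- The state holds the number of elements found and their largest second component; the known
  -- cardinality tells when to stop.
  let step : ℕ → ℕ → ℕ × ℕ → ℕ × ℕ := fun t a q =>
    if a = 0 then q else (q.1 + 1, max t.unpair.2 q.2)
  have hstep : Primrec fun q : ℕ × ℕ × ℕ × ℕ => step q.1 q.2.1 q.2.2 :=
    Primrec.ite (Primrec.eq.comp (.comp .fst .snd) (.const 0)) (.comp .snd .snd)
      (.pair (Primrec.succ.comp (.comp .fst (.comp .snd .snd)))
        (Primrec.nat_max.comp (primrec_unpair_snd .fst) (.comp .snd (.comp .snd .snd))))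
  obtain ⟨G, hG, hG'⟩ := exists_search (0, 0) hstep (R := fun _ _ q => q.1 = n)
    (Primrec.eq.comp (.comp .fst (.comp .snd .snd)) (.const n)) (out := fun _ _ q => q.2)
    (.comp .snd (.comp .snd .snd))
  refine ⟨G, hG, fun S hS k => ?_⟩
  have hrun : ∀ t, run (0, 0) step (charFun S) t =
      ((S.filter (· < t)).card, (S.filter (· < t)).sup fun x => x.unpair.2) := by
    intro t
    induction t with
    | zero => simp [run]
    | succ t ih =>
      rw [run, ih]
      by_cases ht : t ∈ S
      · have hins : S.filter (· < t + 1) = insert t (S.filter (· < t)) := by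
          ext x
          simp only [Finset.mem_filter, Finset.mem_insert, Nat.lt_succ_iff_lt_or_eq]
          constructor
          · rintro ⟨h1, h2 | h2⟩
            · exact .inr ⟨h1, h2⟩
            · exact .inl h2
          · rintro (rfl | ⟨h1, h2⟩)
            · exact ⟨ht, .inr rfl⟩
            · exact ⟨h1, .inl h2⟩
        rw [hins, Finset.card_insert_of_notMem (by simp), Finset.sup_insert]
        simp [step, charFun, ht]
      · have hins : S.filter (· < t + 1) = S.filter (· < t) := by
          refine Finset.filter_congr fun x hx => ?_
          have : x ≠ t := fun h => ht (h ▸ hx)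
          omega
        rw [hins]
        simp [step, charFun, ht]
  refine hG' _ k _ ⟨S.sup id + 1, ?_⟩ ?_
  · rw [hrun, Finset.filter_true_of_mem, hS]
    exact fun x hx => Nat.lt_succ_of_le (Finset.le_sup (f := id) hx)
  · intro s hs
    rw [hrun] at hs ⊢
    have : S.filter (· < s) = S :=
      Finset.eq_of_subset_of_card_le (Finset.filter_subset _ _) (by simp only at hs; omega)
    simp only [this]

/-- If two coded vector spaces have the same code, then the numbers of a spanning set of one of them
do not all belong to a proper subspace of the other. -/
theorem exists_mem_of_span_eq_top {K V K' V' : Type} [Field K] [AddCommGroup V] [Module K V]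
    [Field K'] [AddCommGroup V'] [Module K' V'] {p : ℕ → ℕ} {eK : K → ℕ} {eV : V → ℕ} {eK' : K' → ℕ}
    {eV' : V' → ℕ} (h : Codes p eK eV) (h' : Codes p eK' eV') {W : Submodule K V} (hW : W ≠ ⊤)
    {B : Set V'} (hB : Submodule.span K' B = ⊤) :
    ∃ v' ∈ B, ∃ v, eV v = eV' v' ∧ v ∉ W := by
  have hV : ∀ x, x ∈ Set.range eV ↔ x ∈ Set.range eV' := fun x => by
    rw [← not_iff_not, ← h.col_four_eq_zero, h'.col_four_eq_zero]
  have hK : ∀ x, x ∈ Set.range eK ↔ x ∈ Set.range eK' := fun x => by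
    rw [← h.col_zero_eq_one, h'.col_zero_eq_one]
  by_contra! hcon
  -- The subspace `W` carried over by shared numbers. The common code makes the operations agree, so
  -- this is a subspace over `K'`.
  let W' : Submodule K' V' :=
    { carrier := {v' | ∃ v ∈ W, eV v = eV' v'}
      add_mem' := by
        rintro a b ⟨v, hv, hva⟩ ⟨w, hw, hwb⟩
        refine ⟨v + w, W.add_mem hv hw, ?_⟩
        rw [← h.vector_add, hva, hwb, h'.vector_add]
      zero_mem' := ⟨0, W.zero_mem, by rw [← h.vector_zero, h'.vector_zero]⟩
      smul_mem' := by
        rintro a b ⟨v, hv, hva⟩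
        obtain ⟨c, hc⟩ := (hK (eK' a)).2 ⟨a, rfl⟩
        refine ⟨c • v, W.smul_mem c hv, ?_⟩
        rw [← h.vector_smul, hc, hva, h'.vector_smul] }
  have hBW : Submodule.span K' B ≤ W' := by
    rw [Submodule.span_le]
    intro v' hv'
    obtain ⟨v, hv⟩ := (hV (eV' v')).2 ⟨v', rfl⟩
    exact ⟨v, hcon v' hv' v hv, hv⟩
  refine hW (eq_top_iff.2 fun v _ => ?_)
  obtain ⟨v', hv'⟩ := (hV (eV v)).1 ⟨v, rfl⟩
  obtain ⟨w, hw, hwv⟩ := hBW (hB ▸ Submodule.mem_top : v' ∈ Submodule.span K' B)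
  rwa [h.injective_vector (hwv.trans hv')] at hw

/-- Closed choice is reducible to the problem of finding a basis, whether solutions refer to `ℚ` or
to other fields with the same code. -/
theorem CN_strongReducible {n : ℕ} (hn : 2 ≤ n) {Q : Set ((ℕ → ℕ) × (ℕ → ℕ))}
    (hQ : VSBOver ℚ n ⊆ Q) (hQ' : Q ⊆ VSB n) : StrongReducible CN Q := by
  obtain ⟨d, rfl⟩ := Nat.exists_eq_add_of_le' hn
  obtain ⟨F, hF, hF'⟩ := exists_functional_space d
  obtain ⟨G, hG, hG'⟩ := exists_functional_sup (d + 2)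
  refine strongReducible_of name_injective_fun name_injective_nat hF hG ?_
  intro f hf
  obtain ⟨eV, hlim, m, hm, hguess⟩ := exists_isLimitNumbering d (f := f) hf
  have hcodes := codes_codeValue hlim.injective
  refine ⟨_, hF' f eV hlim, ?_, ?_⟩
  · let b := Pi.basisFun ℚ (Fin (d + 2))
    exact ⟨_, hQ (hcodes.mem_VSBOver (by simp) b.linearIndependent)⟩
  · intro r hr
    obtain ⟨K, _, V, _, _, eK', eV', B, hcodes', hrank, hlin, hspan, hrB⟩ := hQ' hr
    change r = charFun (eV' '' B) at hrB
    have hcard : Cardinal.mk B = (d + 2 : ℕ) := by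
      rw [← rank_span_set hlin, hspan, rank_top, hrank]
    have hfin : B.Finite := by
      rw [← Cardinal.lt_aleph0_iff_set_finite, hcard]
      exact Cardinal.natCast_lt_aleph0
    let S : Finset ℕ := (hfin.image eV').toFinset
    have hS : (S : Set ℕ) = eV' '' B := Set.Finite.coe_toFinset _
    have hScard : S.card = d + 2 := by
      rw [← Set.ncard_coe_finset, hS, Set.ncard_image_of_injective _ hcodes'.injective_vector,
        Set.ncard, Set.encard, ENat.card, hcard]
      simp
    have hsup : S.sup (fun x => x.unpair.2) = m := by
      refine le_antisymm (Finset.sup_le fun x hx => ?_) ?_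
      · obtain ⟨v', -, rfl⟩ := hS ▸ Finset.mem_coe.2 hx
        obtain ⟨v, hv⟩ : eV' v' ∈ Set.range eV := by
          by_contra hcon
          exact hcodes'.col_four_eq_zero.1 (hcodes.col_four_eq_zero.2 hcon) ⟨v', rfl⟩
        rw [← hv]
        exact (hguess v).1
      -- Some basis member lies off this hyperplane, so its number contains the final guess.
      · let W : Submodule ℚ (Fin (d + 2) → ℚ) := LinearMap.ker (LinearMap.proj 1)
        have hW : W ≠ ⊤ := fun hW => by
          have : (Pi.single 1 1 : Fin (d + 2) → ℚ) ∈ W := hW ▸ Submodule.mem_top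
          simp [W] at this
        obtain ⟨v', hv', v, hv, hvW⟩ := exists_mem_of_span_eq_top hcodes hcodes' hW hspan
        have heq : (eV v).unpair.2 = m := by
          by_contra hne
          exact hvW ((hguess v).2 hne)
        rw [← heq, hv]
        have hmem : eV' v' ∈ S := Finset.mem_coe.1 (hS ▸ ⟨v', hv', rfl⟩)
        exact Finset.le_sup (f := fun x => x.unpair.2) hmem
    refine ⟨m, fun k => ?_, hm⟩
    have := hG' S hScard k
    rw [hsup, hS, ← hrB] at this
    exact this

end WR

theorem mainTheorem8 (n : ℕ) (hn : 2 ≤ n) :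
    WR.StrongEquiv (WR.VSB n) WR.CN ∧ WR.StrongEquiv (WR.VSBOver ℚ n) WR.CN := by
  have hn0 : n ≠ 0 := by omega
  have hsub : WR.VSBOver ℚ n ⊆ WR.VSB n := fun _ hx => ⟨ℚ, _, hx⟩
  exact ⟨⟨WR.VSB_strongReducible_CN n hn0, WR.CN_strongReducible hn hsub subset_rfl⟩,
    ⟨WR.VSBOver_strongReducible_CN ℚ n hn0, WR.CN_strongReducible hn subset_rfl hsub⟩⟩
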